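/- Let $n\in\mathbb N$ and let $\chi\in C^\infty_0(\mathbb R)$ be even with $0\le\chi\le1$, $\chi(t)=1$ for $|t|\le 11/10$ and $\chi(t)=0$ for $|t|\ge 19/10$. For $k\ge 0$ let $S_k=\chi_k(D_x)$ be the Fourier multiplier on $\mathbb R^n$ with symbol $\chi_k(\xi)=\chi(2^{-k}|\xi|)$, that is, convolution with the inverse Fourier transform of $\chi_k$; let $S_{-1}=0$ and $\Delta_k=S_k-S_{k-1}$ for $k\ge0$. Let $H^s=H^s(\mathbb R^n)$ be the $L^2$-based Sobolev spaces of complex-valued tempered distributions, and let $\mathrm{Lip}$ be the space of bounded Lipschitz continuous functions $a:\mathbb R^n\to\mathbb C$, with $\|a\|_{\mathrm{Lip}}=\|a\|_{L^\infty}+\|\nabla a\|_{L^\infty}$. For $m\in\mathbb N=\{0,1,2,\dots\}$, $a\in L^\infty(\mathbb R^n;\mathbb C)$ and $u\in H^s$, $s\in\mathbb R$, the modified paraproduct is $$T^m_a u=S_{m-1}a\,S_{m+1}u+\sum_{k=m+2}^{+\infty}S_{k-3}a\,\Delta_k u ,$$ where the series is taken in the space of tempered distributions. (i) Let $m\in\mathbb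 N$ and $s\in\mathbb R$. There is a constant $C_{m,s}$ (depending only on $n,\chi,m,s$) such that, for all $a\in L^\infty$ and $u\in H^s$, the series defining $T^m_a u$ converges unconditionally, $T^m_a u\in H^s$, and $$\|T^m_a u\|_{H^s}\le C_{m,s}\,\|a\|_{L^\infty}\|u\|_{H^s}.$$ (ii) Let $m\in\mathbb N$ and $s\in(0,1)$. There is a constant $C_{m,s}$ (depending only on $n,\chi,m,s$) such that, for all $a\in\mathrm{Lip}$ and $u\in H^{-s}$, the product $au$ is well defined as a tempered distribution by $\langle au,\varphi\rangle=\langle u,a\varphi\rangle_{H^{-s},H^{s}}$ for all Schwartz functions $\varphi$ (where $a\varphi\in H^s$), $au-T^m_a u\in H^{1-s}$, and $$\|au-T^m_a u\|_{H^{1-s}}\le C_{m,s}\,\|a\|_{\mathrm{Lip}}\|u\|_{H^{-s}}.$$ -/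

import Mathlib

open MeasureTheory TemperedDistribution FourierTransform
open scoped SchwartzMap ContDiff

namespace Paraproduct

/-- The admissible Littlewood-Paley cut-off functions `χ : ℝ → ℝ`. -/
structure IsCutoff (χ : ℝ → ℝ) : Prop where
  smooth : ContDiff ℝ ∞ χ
  nonneg : ∀ t, 0 ≤ χ t
  le_one : ∀ t, χ t ≤ 1
  even : ∀ t, χ (-t) = χ t
  eq_one : ∀ t, |t| ≤ 11 / 10 → χ t = 1
  eq_zero : ∀ t, 19 / 10 ≤ |t| → χ t = 0

section

variable {E : Type*} [NormedAddCommGroup E] [InnerProductSpace ℝ E] [FiniteDimensional ℝ E]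
  [MeasurableSpace E] [BorelSpace E]

/-- The symbol `χ_k(ξ) = χ (2 ^ (-k) * |ξ|)`, written in the frequency variable of Mathlib's
Fourier transform `𝓕 u(η) = ∫ exp (-2πi⟨x, η⟩) u(x) dx`, that is, with `ξ = 2πη`. Thus the Fourier
multiplier with this symbol is `χ_k(D)`, where `D = -i∇`. -/
noncomputable def symbol (χ : ℝ → ℝ) (k : ℤ) (η : E) : ℂ :=
  ((χ ((2 : ℝ) ^ (-k) * (2 * Real.pi * ‖η‖)) : ℝ) : ℂ)

/-- `S_k u = χ_k(D) u` for tempered distributions `u` and `k ≥ 0`, and `S_{-1} u = 0`. -/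
noncomputable def lowFreq (χ : ℝ → ℝ) (k : ℤ) (u : 𝓢'(E, ℂ)) : 𝓢'(E, ℂ) :=
  if k < 0 then 0 else TemperedDistribution.fourierMultiplierCLM ℂ (symbol χ k) u

/-- The Littlewood-Paley block `Δ_k u = S_k u - S_{k-1} u`, so that `Δ_0 u = S_0 u`. -/
noncomputable def block (χ : ℝ → ℝ) (k : ℕ) (u : 𝓢'(E, ℂ)) : 𝓢'(E, ℂ) :=
  lowFreq χ k u - lowFreq χ ((k : ℤ) - 1) u

/-- The convolution kernel of `S_k`: the inverse Fourier transform of `χ_k`. -/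
noncomputable def kernel (χ : ℝ → ℝ) (k : ℤ) : E → ℂ :=
  𝓕⁻ (symbol χ k : E → ℂ)

/-- `S_k a` for a bounded function `a`, as a function: it is the convolution of `a` with the inverse
Fourier transform of `χ_k` if `k ≥ 0`, and `S_{-1} a = 0`. -/
noncomputable def lowFreqFun (χ : ℝ → ℝ) (k : ℤ) (a : E → ℂ) : E → ℂ :=
  if k < 0 then 0 else convolution (kernel χ k) a (ContinuousLinearMap.mul ℝ ℂ) volume

/-- The terms `S_{k-3} a Δ_k u` of the paraproduct. For bounded `a` the function `S_{k-3} a` is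
smooth with bounded derivatives, so this is the product of such a function and a tempered
distribution. -/
noncomputable def paraTerm (χ : ℝ → ℝ) (a : E → ℂ) (u : 𝓢'(E, ℂ)) (k : ℕ) : 𝓢'(E, ℂ) :=
  smulLeftCLM ℂ (lowFreqFun χ ((k : ℤ) - 3) a) (block χ k u)

/-- The modified paraproduct
`T^m_a u = S_{m-1} a S_{m+1} u + ∑_{k ≥ m+2} S_{k-3} a Δ_k u`,
where the series is summed in the space of tempered distributions. -/
noncomputable def modifiedParaproduct (χ : ℝ → ℝ) (m : ℕ) (a : E → ℂ) (u : 𝓢'(E, ℂ)) :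
    𝓢'(E, ℂ) :=
  smulLeftCLM ℂ (lowFreqFun χ ((m : ℤ) - 1) a) (lowFreq χ ((m : ℤ) + 1) u) +
    ∑' j : ℕ, paraTerm χ a u (j + (m + 2))

open Classical in
/-- The norm of the Sobolev space `H^s`: the `L²` norm of the Bessel potential of order `s`
(`0` outside `H^s`). -/
noncomputable def sobolevNorm (s : ℝ) (u : 𝓢'(E, ℂ)) : ℝ :=
  if h : MemSobolev s 2 u then ‖h.choose‖ else 0

/-- The norm of `L^∞`. -/
noncomputable def supNorm {F : Type*} [NormedAddCommGroup F] (a : E → F) : ℝ :=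
  (eLpNorm a ⊤ volume).toReal

/-- The space `Lip` of bounded Lipschitz continuous functions. -/
def MemLip (a : E → ℂ) : Prop :=
  (∃ M : ℝ, ∀ x, ‖a x‖ ≤ M) ∧ ∃ K, LipschitzWith K a

/-- The norm `‖a‖_{L^∞} + ‖∇a‖_{L^∞}` of `Lip`; the gradient exists almost everywhere. -/
noncomputable def lipNorm (a : E → ℂ) : ℝ :=
  supNorm a + supNorm (fderiv ℝ a)

/-- `IsDualPairing s u w c`: `u` is in `H^{-s}`, `w` is in `H^s`, and `c = ⟨u, w⟩` is the value of
the bilinear duality bracket of these spaces, that is, the integral of the product of the `L²`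
functions `J^{-s} u` and `J^s w`, where `J^s` is the Bessel potential of order `s`. -/
def IsDualPairing (s : ℝ) (u w : 𝓢'(E, ℂ)) (c : ℂ) : Prop :=
  ∃ f g : Lp ℂ 2 (volume : Measure E),
    besselPotential E ℂ (-s) u = f ∧ besselPotential E ℂ s w = g ∧ c = ∫ x, f x * g x

/-- `IsProduct s a u v`: the product of the function `a` and the distribution `u ∈ H^{-s}` is the
tempered distribution `v`, that is, for all test functions `φ` the function `a φ` is in `L²` and in
`H^s`, and `⟨v, φ⟩ = ⟨u, a φ⟩`, where the bracket on the right is the duality bracket of `H^{-s}`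
and `H^s`. -/
def IsProduct (s : ℝ) (a : E → ℂ) (u v : 𝓢'(E, ℂ)) : Prop :=
  ∀ φ : 𝓢(E, ℂ), ∃ w : Lp ℂ 2 (volume : Measure E),
    (w =ᵐ[volume] fun x ↦ a x * φ x) ∧ IsDualPairing s u w (v φ)

theorem toTemperedDistribution_inj {f g : Lp ℂ 2 (volume : Measure E)}
    (h : (f : 𝓢'(E, ℂ)) = g) : f = g := by
  have hk := Lp.ker_toTemperedDistributionCLM_eq_bot (F := ℂ) (μ := (volume : Measure E)) (p := 2)
  exact LinearMap.ker_eq_bot.mp hk h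

theorem sobolevNorm_eq {s : ℝ} {u : 𝓢'(E, ℂ)} {f : Lp ℂ 2 (volume : Measure E)}
    (h : besselPotential E ℂ s u = f) : sobolevNorm s u = ‖f‖ := by
  have hm : MemSobolev s 2 u := ⟨f, h⟩
  rw [sobolevNorm, dif_pos hm, toTemperedDistribution_inj (hm.choose_spec.symm.trans h)]

theorem IsProduct.unique {s : ℝ} {a : E → ℂ} {u v v' : 𝓢'(E, ℂ)}
    (h : IsProduct s a u v) (h' : IsProduct s a u v') : v = v' := by
  ext φ
  obtain ⟨w, hw, f, g, hf, hg, hc⟩ := h φ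
  obtain ⟨w', hw', f', g', hf', hg', hc'⟩ := h' φ
  have e : w = w' := Lp.ext (hw.trans hw'.symm)
  subst e
  rw [hc, hc', toTemperedDistribution_inj (hf.symm.trans hf'),
    toTemperedDistribution_inj (hg.symm.trans hg')]

end

end Paraproduct

/-!
The difference `a u - T^m_a u` is the series `∑_{j ≥ 0} Δ_{j+m} a S_{j+m+2} u`. Indeed, summation by
parts shows that the `j`-th terms of this series and of the paraproduct add up to the increment of
`S_{N+m-1} a S_{N+m+1} u` between `N = j` and `N = j + 1` (`paraTerm_add_remainderTerm`), and
these products converge to `a u`.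

Both series have the form `∑ b_i P_i u` with Fourier multipliers `P_i` and functions `b_i` of low
frequency. Tested against a Schwartz function `φ`, the term `b_i P_i u` only sees a part `Q_i φ` of
it, since the frequencies of `P_i` and `b_i` are bounded (`fourierInv_lowFreqFun_smul_eq_zero`,
`Localizes`). Thus `|⟨b_i P_i u, φ⟩| ≤ ‖b_i‖_∞ ‖P_i u‖ ‖Q_i φ‖` in `L²` norms, and the
Cauchy-Schwarz inequality in `i` bounds the sum by Sobolev norms of `u` and `φ`, provided that the
squares of the symbols, with suitable powers of `2 ^ i` as weights, add up to at most a power of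
`1 + |ξ| ^ 2` (`sum_norm_smul_multiplier_le`). By duality the series converges unconditionally,
with a bound in the Sobolev space (`summable_of_sum_norm_le`, `summable_smul_multiplier`).

For the paraproduct `P_i` and `Q_i` live on dyadic annuli, and the weights may have exponents of any
sign (`exists_sum_sq_fatSymbol_le`). For the remainder they live on dyadic balls, and the sums of
the weights are geometric series because `s` and `1 - s` are positive (`exists_sum_sq_symbol_le`);
the gain of one derivative is the bound `‖Δ_k a‖_∞ ≤ C 2 ^ (-k) ‖a‖_Lip`
(`exists_norm_lowFreqFun_sub_le`). The latter uses that the Lipschitz constant of `a` is the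
essential supremum of its gradient (`norm_sub_le_of_ae_norm_fderiv_le`).

For a Schwartz function `φ` in place of `u` the products converge to the function `a φ`
(`tendsto_approxProduct_schwartz`). Hence `a φ` is the sum of its paraproduct and its remainder,
which puts it in `H^s`. The identity `⟨T^m_a u + ∑ Δ_{j+m} a S_{j+m+2} u, φ⟩ = ⟨u, a φ⟩` follows for
Schwartz functions `u`, and then for `u ∈ H^{-s}` by density and continuity
(`isProduct_add_remainder`).
-/

set_option linter.unusedSectionVars false

namespace Paraproduct

/-! ### `L²` norms of products -/

section L2

variable {α : Type*} [MeasurableSpace α] {μ : Measure α}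

theorem sq_lpNorm_two {F : Type*} [NormedAddCommGroup F] {f : α → F} (hf : MemLp f 2 μ) :
    lpNorm f 2 μ ^ 2 = ∫ x, ‖f x‖ ^ 2 ∂μ := by
  have h0 : (0 : ℝ) ≤ ∫ x, ‖f x‖ ^ 2 ∂μ := integral_nonneg fun x ↦ by positivity
  rw [lpNorm_eq_integral_norm_rpow_toReal (by simp) (by simp) hf.1]
  simp only [ENNReal.toReal_ofNat, Real.rpow_ofNat]
  rw [← Real.rpow_natCast, ← Real.rpow_mul h0]
  norm_num

/-- The Cauchy-Schwarz inequality for the bilinear pairing of two `L²` functions. -/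
theorem norm_integral_mul_le {f g : α → ℂ} (hf : MemLp f 2 μ) (hg : MemLp g 2 μ) :
    ‖∫ x, f x * g x ∂μ‖ ≤ lpNorm f 2 μ * lpNorm g 2 μ := by
  have h := norm_inner_le_norm (𝕜 := ℂ) (hf.star.toLp (star f)) (hg.toLp g)
  rw [L2.inner_def, Lp.norm_toLp, Lp.norm_toLp, eLpNorm_star, toReal_eLpNorm hf.1,
    toReal_eLpNorm hg.1] at h
  refine le_trans (le_of_eq ?_) h
  congr 1
  refine integral_congr_ae ?_
  filter_upwards [hf.star.coeFn_toLp, hg.coeFn_toLp] with x h1 h2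
  rw [h1, h2]
  simp [mul_comm]

theorem memLp_bdd_mul {f g : α → ℂ} {C : ℝ} (hg : MemLp g 2 μ) (hf : AEStronglyMeasurable f μ)
    (hC : ∀ᵐ x ∂μ, ‖f x‖ ≤ C) : MemLp (fun x ↦ f x * g x) 2 μ :=
  MemLp.of_le_mul hg (hf.mul hg.1) (c := C) <| by
    filter_upwards [hC] with x hx
    rw [norm_mul]
    gcongr

theorem lpNorm_bdd_mul_le {f g : α → ℂ} {C : ℝ} (hC0 : 0 ≤ C) (hg : MemLp g 2 μ)
    (hf : AEStronglyMeasurable f μ) (hC : ∀ᵐ x ∂μ, ‖f x‖ ≤ C) :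
    lpNorm (fun x ↦ f x * g x) 2 μ ≤ C * lpNorm g 2 μ := by
  have h := memLp_bdd_mul hg hf hC
  refine le_of_sq_le_sq ?_ (mul_nonneg hC0 lpNorm_nonneg)
  rw [mul_pow, sq_lpNorm_two h, sq_lpNorm_two hg, ← integral_const_mul]
  refine integral_mono_ae h.norm.integrable_sq (hg.norm.integrable_sq.const_mul _) ?_
  filter_upwards [hC] with x hx
  rw [norm_mul, mul_pow]
  gcongr

/-- If the squares of the functions `σ i` sum to at most `C ^ 2`, then the squares of the `L²`
norms of the pieces `σ i * g` sum to at most `C ^ 2` times that of `g`. -/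
theorem sum_sq_lpNorm_mul_le {ι : Type*} (s : Finset ι) {σ : ι → α → ℂ} {g : α → ℂ} {C : ℝ}
    (hg : MemLp g 2 μ) (hσ : ∀ i, AEStronglyMeasurable (σ i) μ)
    (hC : ∀ x, ∑ i ∈ s, ‖σ i x‖ ^ 2 ≤ C ^ 2) :
    ∑ i ∈ s, lpNorm (fun x ↦ σ i x * g x) 2 μ ^ 2 ≤ C ^ 2 * lpNorm g 2 μ ^ 2 := by
  have hb : ∀ i ∈ s, ∀ x, ‖σ i x‖ ≤ |C| := fun i hi x ↦ by
    rw [← abs_of_nonneg (norm_nonneg (σ i x))]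
    exact sq_le_sq.mp
      ((Finset.single_le_sum (f := fun i ↦ ‖σ i x‖ ^ 2) (fun j _ ↦ by positivity) hi).trans (hC x))
  have hm : ∀ i ∈ s, MemLp (fun x ↦ σ i x * g x) 2 μ := fun i hi ↦
    memLp_bdd_mul hg (hσ i) (.of_forall (hb i hi))
  rw [Finset.sum_congr rfl fun i hi ↦ sq_lpNorm_two (hm i hi),
    ← integral_finsetSum _ fun i hi ↦ (hm i hi).norm.integrable_sq, sq_lpNorm_two hg,
    ← integral_const_mul]
  refine integral_mono (integrable_finsetSum _ fun i hi ↦ (hm i hi).norm.integrable_sq)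
    (hg.norm.integrable_sq.const_mul _) fun x ↦ ?_
  simp only [norm_mul, mul_pow, ← Finset.sum_mul]
  gcongr
  exact hC x

end L2

/-! ### Sobolev norms on the Fourier side -/

section Sobolev

variable {E : Type*} [NormedAddCommGroup E] [InnerProductSpace ℝ E] [FiniteDimensional ℝ E]
  [MeasurableSpace E] [BorelSpace E]

theorem lpNorm_coe_lp (f : Lp ℂ 2 (volume : Measure E)) : lpNorm f 2 volume = ‖f‖ := by
  rw [Lp.norm_def, toReal_eLpNorm (Lp.aestronglyMeasurable f)]

theorem lpNorm_schwartz (φ : 𝓢(E, ℂ)) : lpNorm φ 2 (volume : Measure E) = ‖φ.toLp 2‖ := by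
  rw [SchwartzMap.norm_toLp, toReal_eLpNorm φ.continuous.aestronglyMeasurable]

theorem lpNorm_fourierInv (φ : 𝓢(E, ℂ)) :
    lpNorm (𝓕⁻ φ : 𝓢(E, ℂ)) 2 (volume : Measure E) = lpNorm φ 2 volume := by
  rw [lpNorm_schwartz, lpNorm_schwartz, ← SchwartzMap.norm_fourier_toL2_eq, fourier_fourierInv_eq]

theorem lpNorm_fourier (φ : 𝓢(E, ℂ)) :
    lpNorm (𝓕 φ : 𝓢(E, ℂ)) 2 (volume : Measure E) = lpNorm φ 2 volume := by
  rw [lpNorm_schwartz, lpNorm_schwartz, SchwartzMap.norm_fourier_toL2_eq]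

/-- A linear functional on Schwartz functions that is bounded in the `L²` norm is the pairing with
an `L²` function. -/
theorem exists_lp_eq_of_bound (L : 𝓢(E, ℂ) →ₗ[ℂ] ℂ) {C : ℝ} (hC : 0 ≤ C)
    (h : ∀ φ, ‖L φ‖ ≤ C * lpNorm φ 2 volume) :
    ∃ f : Lp ℂ 2 (volume : Measure E), ‖f‖ ≤ C ∧ ∀ φ, L φ = (f : 𝓢'(E, ℂ)) φ := by
  let e : 𝓢(E, ℂ) →ₗ[ℂ] Lp ℂ 2 (volume : Measure E) :=
    (SchwartzMap.toLpCLM ℂ (E := E) ℂ 2 volume).toLinearMap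
  have hd : DenseRange e := SchwartzMap.denseRange_toLpCLM (E := E) (F := ℂ) (p := 2) (μ := volume)
    ENNReal.ofNat_ne_top
  have hb : ∀ φ, ‖L φ‖ ≤ C * ‖e φ‖ := fun φ ↦ by
    have := h φ
    rwa [lpNorm_schwartz] at this
  let ℓ : StrongDual ℂ (Lp ℂ 2 (volume : Measure E)) := L.extendOfNorm e
  have hℓ : ‖ℓ‖ ≤ C := LinearMap.opNorm_extendOfNorm_le hd hC hb
  let g := (InnerProductSpace.toDual ℂ (Lp ℂ 2 (volume : Measure E))).symm ℓ
  have hg : ‖g‖ = ‖ℓ‖ := LinearIsometryEquiv.norm_map _ _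
  refine ⟨star g, ?_, fun φ ↦ ?_⟩
  · rw [Lp.norm_def, eLpNorm_congr_ae (Lp.coeFn_star g), eLpNorm_star, ← Lp.norm_def, hg]
    exact hℓ
  · have h1 : L φ = ℓ (e φ) := (LinearMap.extendOfNorm_eq hd ⟨C, hb⟩ φ).symm
    rw [h1, ← InnerProductSpace.toDual_symm_apply, Lp.toTemperedDistribution_apply, L2.inner_def]
    refine integral_congr_ae ?_
    filter_upwards [Lp.coeFn_star g, φ.coeFn_toLp 2 volume] with x hx hx'
    rw [hx]
    have : (e φ : E → ℂ) x = φ x := hx'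
    rw [this]
    simp [g]

/-- The weight `(1 + |ξ| ^ 2) ^ (r / 2)`, the symbol of the Bessel potential of order `r`. Here `ξ`
is the frequency variable of `𝓕`, without the factor `2π` that occurs in `symbol`. -/
noncomputable def bracket (r : ℝ) (ξ : E) : ℂ := ((1 + ‖ξ‖ ^ 2) ^ (r / 2) : ℝ)

@[fun_prop]
theorem hasTemperateGrowth_bracket (r : ℝ) : (bracket r : E → ℂ).HasTemperateGrowth := by
  unfold bracket
  fun_prop

theorem norm_bracket (r : ℝ) (ξ : E) : ‖bracket r ξ‖ = (1 + ‖ξ‖ ^ 2) ^ (r / 2) := by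
  rw [bracket, Complex.norm_real, Real.norm_of_nonneg (by positivity)]

theorem norm_bracket_sq (r : ℝ) (ξ : E) : ‖bracket r ξ‖ ^ 2 = (1 + ‖ξ‖ ^ 2) ^ r := by
  rw [norm_bracket, ← Real.rpow_natCast, ← Real.rpow_mul (by positivity)]
  norm_num

theorem bracket_mul_bracket (r r' : ℝ) (ξ : E) :
    bracket r ξ * bracket r' ξ = bracket (r + r') ξ := by
  rw [bracket, bracket, bracket, ← Complex.ofReal_mul, ← Real.rpow_add (by positivity), add_div]

theorem bracket_neg_mul_bracket (r : ℝ) (ξ : E) : bracket (-r) ξ * bracket r ξ = 1 := by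
  rw [bracket_mul_bracket]
  simp [bracket]

/-- The `H^r` norm of a Schwartz function, computed with the inverse Fourier transform: the weight
is even, and this transform appears when an operator is moved to the test function. -/
noncomputable def testNorm (r : ℝ) (φ : 𝓢(E, ℂ)) : ℝ :=
  lpNorm (fun ξ ↦ bracket r ξ * (𝓕⁻ φ : 𝓢(E, ℂ)) ξ) 2 (volume : Measure E)

theorem testNorm_nonneg (r : ℝ) (φ : 𝓢(E, ℂ)) : 0 ≤ testNorm r φ := lpNorm_nonneg

theorem memLp_temperate_mul {p : E → ℂ} (hp : p.HasTemperateGrowth) (φ : 𝓢(E, ℂ)) :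
    MemLp (fun ξ ↦ p ξ * φ ξ) 2 (volume : Measure E) := by
  have : (fun ξ ↦ p ξ * φ ξ) = SchwartzMap.smulLeftCLM ℂ p φ := by
    ext ξ; simp [hp]
  rw [this]
  exact SchwartzMap.memLp _ 2 volume

theorem besselPotential_apply (r : ℝ) (u : 𝓢'(E, ℂ)) (φ : 𝓢(E, ℂ)) :
    besselPotential E ℂ r u φ = u (𝓕 (SchwartzMap.smulLeftCLM ℂ (bracket r) (𝓕⁻ φ))) := rfl

theorem testNorm_bessel (r : ℝ) (φ : 𝓢(E, ℂ)) :
    testNorm (-r) (𝓕 (SchwartzMap.smulLeftCLM ℂ (bracket r) (𝓕⁻ φ))) = lpNorm φ 2 volume := by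
  rw [testNorm, fourierInv_fourier_eq, ← lpNorm_fourierInv]
  congr 1
  ext ξ
  rw [SchwartzMap.smulLeftCLM_apply_apply (by fun_prop), smul_eq_mul, ← mul_assoc,
    bracket_neg_mul_bracket, one_mul]

/-- A tempered distribution in `H^t` is, on the Fourier side, the pairing with a weighted `L²`
function. -/
theorem exists_fourier_repr {t : ℝ} {u : 𝓢'(E, ℂ)} (hu : MemSobolev t 2 u) :
    ∃ G : Lp ℂ 2 (volume : Measure E), ‖G‖ = sobolevNorm t u ∧
      ∀ ψ : 𝓢(E, ℂ), u (𝓕 ψ) = ∫ ξ, (bracket (-t) ξ * ψ ξ) * G ξ := by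
  obtain ⟨f, hf⟩ := hu
  refine ⟨𝓕 f, by rw [Lp.norm_fourier_eq, sobolevNorm_eq hf], fun ψ ↦ ?_⟩
  have h1 : 𝓕 (besselPotential E ℂ t u) (SchwartzMap.smulLeftCLM ℂ (bracket (-t)) ψ) =
      u (𝓕 ψ) := by
    rw [TemperedDistribution.fourier_apply, besselPotential_apply, fourierInv_fourier_eq]
    congr 2
    ext ξ
    rw [SchwartzMap.smulLeftCLM_apply_apply (by fun_prop),
      SchwartzMap.smulLeftCLM_apply_apply (by fun_prop), smul_eq_mul, smul_eq_mul, ← mul_assoc,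
      mul_comm (bracket t ξ), bracket_neg_mul_bracket, one_mul]
  rw [← h1, hf, Lp.fourier_toTemperedDistribution_eq, Lp.toTemperedDistribution_apply]
  refine integral_congr_ae (.of_forall fun ξ ↦ ?_)
  simp only [smul_eq_mul]
  rw [SchwartzMap.smulLeftCLM_apply_apply (by fun_prop), smul_eq_mul]

theorem sobolevNorm_nonneg (t : ℝ) (u : 𝓢'(E, ℂ)) : 0 ≤ sobolevNorm t u := by
  unfold sobolevNorm
  split_ifs <;> positivity

theorem norm_apply_le_sobolevNorm {t : ℝ} {u : 𝓢'(E, ℂ)} (hu : MemSobolev t 2 u) (φ : 𝓢(E, ℂ)) :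
    ‖u φ‖ ≤ sobolevNorm t u * testNorm (-t) φ := by
  obtain ⟨G, hG, h⟩ := exists_fourier_repr hu
  have e : φ = 𝓕 (𝓕⁻ φ : 𝓢(E, ℂ)) := (fourier_fourierInv_eq φ).symm
  conv_lhs => rw [e]
  rw [h, ← hG, ← lpNorm_coe_lp, mul_comm, testNorm]
  exact norm_integral_mul_le (memLp_temperate_mul (by fun_prop) _) (Lp.memLp G)

/-- If a family of tempered distributions is absolutely summable against test functions, with a
bound by the `H^{-t}` norm of the test function, then it is summable and its sum is in `H^t`. -/
theorem summable_of_sum_norm_le {ι : Type*} {t : ℝ} {τ : ι → 𝓢'(E, ℂ)} {C : ℝ} (hC : 0 ≤ C)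
    (h : ∀ (s : Finset ι) (φ : 𝓢(E, ℂ)), ∑ i ∈ s, ‖τ i φ‖ ≤ C * testNorm (-t) φ) :
    Summable τ ∧ MemSobolev t 2 (∑' i, τ i) ∧ sobolevNorm t (∑' i, τ i) ≤ C := by
  have hs : ∀ φ, Summable fun i ↦ τ i φ := fun φ ↦
    Summable.of_norm (summable_of_sum_le (fun i ↦ norm_nonneg _) fun s ↦ h s φ)
  let A : 𝓢(E, ℂ) →L[ℂ] 𝓢(E, ℂ) := fourierCLM ℂ 𝓢(E, ℂ) ∘L
    SchwartzMap.smulLeftCLM ℂ (bracket t) ∘L fourierInvCLM ℂ 𝓢(E, ℂ)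
  have hA : ∀ φ, A φ = 𝓕 (SchwartzMap.smulLeftCLM ℂ (bracket t) (𝓕⁻ φ)) := fun φ ↦ rfl
  let L : 𝓢(E, ℂ) →ₗ[ℂ] ℂ :=
    { toFun := fun φ ↦ ∑' i, τ i (A φ)
      map_add' := fun φ ψ ↦ by simp only [map_add]; exact (hs _).tsum_add (hs _)
      map_smul' := fun c φ ↦ by simp only [map_smul, smul_eq_mul, RingHom.id_apply, tsum_mul_left] }
  obtain ⟨f, hf, hfL⟩ := exists_lp_eq_of_bound L hC fun φ ↦ by
    rw [← testNorm_bessel t φ, ← hA]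
    refine (norm_tsum_le_tsum_norm (hs _).norm).trans ?_
    exact (hs _).norm.tsum_le_of_sum_le fun s ↦ h s _
  have hsum : HasSum τ (besselPotential E ℂ (-t) f) := by
    refine PointwiseConvergenceCLM.tendsto_iff_forall_tendsto.mpr fun φ ↦ ?_
    have h1 : besselPotential E ℂ (-t) f φ = ∑' i, τ i φ := by
      rw [besselPotential_apply, ← hfL]
      change ∑' i, τ i (A _) = _
      congr! 3 with i
      rw [hA, fourierInv_fourier_eq]
      conv_rhs => rw [← fourier_fourierInv_eq (F := 𝓢(E, ℂ)) φ]
      congr 1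
      ext ξ
      rw [SchwartzMap.smulLeftCLM_apply_apply (by fun_prop),
        SchwartzMap.smulLeftCLM_apply_apply (by fun_prop), smul_eq_mul, smul_eq_mul, ← mul_assoc,
        mul_comm (bracket t ξ), bracket_neg_mul_bracket, one_mul]
    rw [h1]
    refine (hs φ).hasSum.congr fun s ↦ ?_
    simp
  have hb : besselPotential E ℂ t (∑' i, τ i) = f := by
    rw [hsum.tsum_eq]; simp
  exact ⟨hsum.summable, ⟨f, hb⟩, (sobolevNorm_eq hb).trans_le hf⟩

/-! ### Sums of localized products -/

/-- On the support of `p`, the Fourier transform of the product `b * φ` only depends on the part of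
`φ` singled out by the multiplier `q`. -/
def Localizes (p q b : E → ℂ) : Prop :=
  ∀ (φ : 𝓢(E, ℂ)) ξ, p ξ * (𝓕⁻ (SchwartzMap.smulLeftCLM ℂ b φ) : 𝓢(E, ℂ)) ξ =
    p ξ * (𝓕⁻ (SchwartzMap.smulLeftCLM ℂ b
      (𝓕 (SchwartzMap.smulLeftCLM ℂ q (𝓕⁻ φ)))) : 𝓢(E, ℂ)) ξ

/-- The finite sums in the estimate of `∑ b_i P_i u`, where `P_i` is the Fourier multiplier with
symbol `p_i`. By `hloc` only the part `Q_i φ` of the test function `φ` enters the `i`-th term, which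
is therefore at most `B (β_i ‖P_i u‖) (γ_i ‖Q_i φ‖)` in `L²` norms, and the Cauchy-Schwarz
inequality for the sum over `i` concludes. The weights `β_i` and `γ_i` distribute the
dyadic powers between the two factors, so that the overlap conditions `h₁` and `h₂` hold. -/
theorem sum_norm_smul_multiplier_le {ι : Type*} {t t' B C₁ C₂ : ℝ} {p q b : ι → E → ℂ}
    {β γ : ι → ℝ} (hB : 0 ≤ B) (hC₁ : 0 ≤ C₁) (hC₂ : 0 ≤ C₂) (hβ : ∀ i, 0 ≤ β i)
    (hγ : ∀ i, 0 ≤ γ i) (hp : ∀ i, (p i).HasTemperateGrowth) (hq : ∀ i, (q i).HasTemperateGrowth)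
    (hb : ∀ i, (b i).HasTemperateGrowth) (hbB : ∀ i x, ‖b i x‖ ≤ B * (β i * γ i))
    (hloc : ∀ i, Localizes (p i) (q i) (b i))
    (h₁ : ∀ (s : Finset ι) (ξ : E), ∑ i ∈ s, (β i * ‖p i ξ‖) ^ 2 ≤ C₁ ^ 2 * (1 + ‖ξ‖ ^ 2) ^ t)
    (h₂ : ∀ (s : Finset ι) (ξ : E), ∑ i ∈ s, (γ i * ‖q i ξ‖) ^ 2 ≤ C₂ ^ 2 * (1 + ‖ξ‖ ^ 2) ^ (-t'))
    {u : 𝓢'(E, ℂ)} (hu : MemSobolev t 2 u) (s : Finset ι) (φ : 𝓢(E, ℂ)) :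
    ∑ i ∈ s, ‖smulLeftCLM ℂ (b i) (fourierMultiplierCLM ℂ (p i) u) φ‖ ≤
      C₁ * C₂ * B * sobolevNorm t u * testNorm (-t') φ := by
  unfold Localizes at hloc
  obtain ⟨G, hG, hGu⟩ := exists_fourier_repr hu
  set σ : ι → E → ℂ := fun i ξ ↦ β i * (bracket (-t) ξ * p i ξ) with hσ
  set ρ : ι → E → ℂ := fun i ξ ↦ γ i * (bracket t' ξ * q i ξ) with hρ
  set H : E → ℂ := fun ξ ↦ bracket (-t') ξ * (𝓕⁻ φ : 𝓢(E, ℂ)) ξ with hH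
  have hHm : MemLp H 2 volume := memLp_temperate_mul (by fun_prop) _
  have hGm : MemLp G 2 volume := Lp.memLp G
  have hσc : ∀ i, AEStronglyMeasurable (σ i) (volume : Measure E) := fun i ↦ by
    have h1 := (hasTemperateGrowth_bracket (E := E) (-t)).1.continuous
    have h2 := (hp i).1.continuous
    exact Continuous.aestronglyMeasurable (by fun_prop)
  have hρc : ∀ i, AEStronglyMeasurable (ρ i) (volume : Measure E) := fun i ↦ by
    have h1 := (hasTemperateGrowth_bracket (E := E) t').1.continuous
    have h2 := (hq i).1.continuous
    exact Continuous.aestronglyMeasurable (by fun_prop)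
  have hσs : ∀ s ξ, ∑ i ∈ s, ‖σ i ξ‖ ^ 2 ≤ C₁ ^ 2 := fun s ξ ↦ by
    have e : ∀ i ∈ s, ‖σ i ξ‖ ^ 2 = (1 + ‖ξ‖ ^ 2) ^ (-t) * (β i * ‖p i ξ‖) ^ 2 := fun i _ ↦ by
      rw [hσ, ← norm_bracket_sq]
      simp only [norm_mul, Complex.norm_real, Real.norm_of_nonneg (hβ i)]
      ring
    rw [Finset.sum_congr rfl e, ← Finset.mul_sum]
    calc _ ≤ (1 + ‖ξ‖ ^ 2) ^ (-t) * (C₁ ^ 2 * (1 + ‖ξ‖ ^ 2) ^ t) := by gcongr; exact h₁ s ξ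
      _ = C₁ ^ 2 * ((1 + ‖ξ‖ ^ 2) ^ (-t) * (1 + ‖ξ‖ ^ 2) ^ t) := by ring
      _ = C₁ ^ 2 := by rw [← Real.rpow_add (by positivity)]; simp
  have hρs : ∀ s ξ, ∑ i ∈ s, ‖ρ i ξ‖ ^ 2 ≤ C₂ ^ 2 := fun s ξ ↦ by
    have e : ∀ i ∈ s, ‖ρ i ξ‖ ^ 2 = (1 + ‖ξ‖ ^ 2) ^ t' * (γ i * ‖q i ξ‖) ^ 2 := fun i _ ↦ by
      rw [hρ, ← norm_bracket_sq]
      simp only [norm_mul, Complex.norm_real, Real.norm_of_nonneg (hγ i)]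
      ring
    rw [Finset.sum_congr rfl e, ← Finset.mul_sum]
    calc _ ≤ (1 + ‖ξ‖ ^ 2) ^ t' * (C₂ ^ 2 * (1 + ‖ξ‖ ^ 2) ^ (-t')) := by gcongr; exact h₂ s ξ
      _ = C₂ ^ 2 * ((1 + ‖ξ‖ ^ 2) ^ t' * (1 + ‖ξ‖ ^ 2) ^ (-t')) := by ring
      _ = C₂ ^ 2 := by rw [← Real.rpow_add (by positivity)]; simp
  have hσG : ∀ i, MemLp (fun ξ ↦ σ i ξ * G ξ) 2 volume := fun i ↦
    memLp_bdd_mul hGm (hσc i) (C := C₁) (.of_forall fun ξ ↦ by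
      have := hσs {i} ξ
      rw [Finset.sum_singleton] at this
      exact le_of_sq_le_sq this hC₁)
  have key : ∀ i, ‖smulLeftCLM ℂ (b i) (fourierMultiplierCLM ℂ (p i) u) φ‖ ≤
      B * (lpNorm (fun ξ ↦ σ i ξ * G ξ) 2 volume * lpNorm (fun ξ ↦ ρ i ξ * H ξ) 2 volume) := by
    intro i
    set ψ : 𝓢(E, ℂ) := 𝓕 (SchwartzMap.smulLeftCLM ℂ (q i) (𝓕⁻ φ)) with hψ
    have e1 : smulLeftCLM ℂ (b i) (fourierMultiplierCLM ℂ (p i) u) φ =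
        ∫ ξ, (bracket (-t) ξ * p i ξ * G ξ) *
          (𝓕⁻ (SchwartzMap.smulLeftCLM ℂ (b i) ψ) : 𝓢(E, ℂ)) ξ := by
      rw [smulLeftCLM_apply_apply, fourierMultiplierCLM_apply_apply, hGu]
      refine integral_congr_ae (.of_forall fun ξ ↦ ?_)
      simp only
      rw [SchwartzMap.smulLeftCLM_apply_apply (hp i), smul_eq_mul, hloc]
      ring
    have e2 : lpNorm (𝓕⁻ (SchwartzMap.smulLeftCLM ℂ (b i) ψ) : 𝓢(E, ℂ)) 2 (volume : Measure E) ≤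
        B * (β i * γ i) * lpNorm (fun ξ ↦ bracket t' ξ * q i ξ * H ξ) 2 volume := by
      have e3 : (SchwartzMap.smulLeftCLM ℂ (b i) ψ : E → ℂ) = fun x ↦ b i x * ψ x := by
        ext x; rw [SchwartzMap.smulLeftCLM_apply_apply (hb i), smul_eq_mul]
      have e4 : lpNorm ψ 2 volume = lpNorm (fun ξ ↦ bracket t' ξ * q i ξ * H ξ) 2 volume := by
        rw [hψ, lpNorm_fourier]
        congr 1
        ext ξ
        rw [SchwartzMap.smulLeftCLM_apply_apply (hq i), smul_eq_mul, hH]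
        linear_combination (- (q i ξ * (𝓕⁻ φ : 𝓢(E, ℂ)) ξ)) * bracket_neg_mul_bracket t' ξ
      rw [lpNorm_fourierInv, e3, ← e4]
      exact lpNorm_bdd_mul_le (mul_nonneg hB (mul_nonneg (hβ i) (hγ i))) (ψ.memLp 2 volume)
        (hb i).1.continuous.aestronglyMeasurable (.of_forall (hbB i))
    have e5 : lpNorm (fun ξ ↦ σ i ξ * G ξ) 2 volume =
        β i * lpNorm (fun ξ ↦ bracket (-t) ξ * p i ξ * G ξ) 2 volume := by
      have := lpNorm_const_smul (p := 2) (β i : ℂ) (fun ξ ↦ bracket (-t) ξ * p i ξ * G ξ) volume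
      simp only [coe_nnnorm, Complex.norm_real, Real.norm_of_nonneg (hβ i)] at this
      rw [← this]
      congr 1
      ext ξ
      simp [hσ, mul_assoc]
    have e6 : lpNorm (fun ξ ↦ ρ i ξ * H ξ) 2 volume =
        γ i * lpNorm (fun ξ ↦ bracket t' ξ * q i ξ * H ξ) 2 volume := by
      have := lpNorm_const_smul (p := 2) (γ i : ℂ) (fun ξ ↦ bracket t' ξ * q i ξ * H ξ) volume
      simp only [coe_nnnorm, Complex.norm_real, Real.norm_of_nonneg (hγ i)] at this
      rw [← this]
      congr 1
      ext ξ
      simp [hρ, mul_assoc]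
    rw [e1, e5, e6]
    -- The weighted function `p_i G` is only known to be in `L²` if `β_i` is nonzero; if `β_i` is
    -- zero, then `b_i` vanishes.
    by_cases hz : β i = 0
    · have hψ0 : lpNorm (𝓕⁻ (SchwartzMap.smulLeftCLM ℂ (b i) ψ) : 𝓢(E, ℂ)) 2
          (volume : Measure E) = 0 := by
        refine le_antisymm (e2.trans (by simp [hz])) lpNorm_nonneg
      have h0 : (𝓕⁻ (SchwartzMap.smulLeftCLM ℂ (b i) ψ) : 𝓢(E, ℂ)) =ᵐ[volume] 0 :=
        (lpNorm_eq_zero (SchwartzMap.memLp _ 2 volume) (by simp)).mp hψ0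
      rw [integral_eq_zero_of_ae (by filter_upwards [h0] with ξ hξ; simp [hξ])]
      simp [hz]
    · have hm : MemLp (fun ξ ↦ bracket (-t) ξ * p i ξ * G ξ) 2 volume := by
        have := (hσG i).const_mul ((β i : ℂ)⁻¹)
        convert this using 2 with ξ
        have : (β i : ℂ) ≠ 0 := by exact_mod_cast hz
        simp only [hσ]
        field_simp
      refine (norm_integral_mul_le hm (SchwartzMap.memLp _ 2 volume)).trans ?_
      calc _ ≤ lpNorm (fun ξ ↦ bracket (-t) ξ * p i ξ * G ξ) 2 volume *
          (B * (β i * γ i) * lpNorm (fun ξ ↦ bracket t' ξ * q i ξ * H ξ) 2 volume) := by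
            gcongr
            exact lpNorm_nonneg
        _ = _ := by ring
  calc _ ≤ ∑ i ∈ s, B * (lpNorm (fun ξ ↦ σ i ξ * G ξ) 2 volume *
        lpNorm (fun ξ ↦ ρ i ξ * H ξ) 2 volume) := Finset.sum_le_sum fun i _ ↦ key i
    _ = B * ∑ i ∈ s, lpNorm (fun ξ ↦ σ i ξ * G ξ) 2 volume *
        lpNorm (fun ξ ↦ ρ i ξ * H ξ) 2 volume := by rw [Finset.mul_sum]
    _ ≤ B * ((C₁ * ‖G‖) * (C₂ * lpNorm H 2 volume)) := by
      gcongr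
      -- Cauchy-Schwarz in the summation index.
      refine (Real.sum_mul_le_sqrt_mul_sqrt _ _ _).trans ?_
      gcongr
      · refine Real.sqrt_le_iff.mpr ⟨by positivity, ?_⟩
        rw [mul_pow, ← lpNorm_coe_lp]
        exact sum_sq_lpNorm_mul_le s hGm hσc (hσs s)
      · refine Real.sqrt_le_iff.mpr ⟨mul_nonneg hC₂ lpNorm_nonneg, ?_⟩
        rw [mul_pow]
        exact sum_sq_lpNorm_mul_le s hHm hρc (hρs s)
    _ = _ := by rw [hG, testNorm]; ring

/-- The main estimate: a series `∑ b_i P_i u` with localized products is bounded from `H^t` to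
`H^{t'}`. -/
theorem summable_smul_multiplier {ι : Type*} {t t' B C₁ C₂ : ℝ} {p q b : ι → E → ℂ}
    {β γ : ι → ℝ} (hB : 0 ≤ B) (hC₁ : 0 ≤ C₁) (hC₂ : 0 ≤ C₂) (hβ : ∀ i, 0 ≤ β i)
    (hγ : ∀ i, 0 ≤ γ i) (hp : ∀ i, (p i).HasTemperateGrowth) (hq : ∀ i, (q i).HasTemperateGrowth)
    (hb : ∀ i, (b i).HasTemperateGrowth) (hbB : ∀ i x, ‖b i x‖ ≤ B * (β i * γ i))
    (hloc : ∀ i, Localizes (p i) (q i) (b i))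
    (h₁ : ∀ (s : Finset ι) (ξ : E), ∑ i ∈ s, (β i * ‖p i ξ‖) ^ 2 ≤ C₁ ^ 2 * (1 + ‖ξ‖ ^ 2) ^ t)
    (h₂ : ∀ (s : Finset ι) (ξ : E), ∑ i ∈ s, (γ i * ‖q i ξ‖) ^ 2 ≤ C₂ ^ 2 * (1 + ‖ξ‖ ^ 2) ^ (-t'))
    {u : 𝓢'(E, ℂ)} (hu : MemSobolev t 2 u) :
    (Summable fun i ↦ smulLeftCLM ℂ (b i) (fourierMultiplierCLM ℂ (p i) u)) ∧
      MemSobolev t' 2 (∑' i, smulLeftCLM ℂ (b i) (fourierMultiplierCLM ℂ (p i) u)) ∧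
      sobolevNorm t' (∑' i, smulLeftCLM ℂ (b i) (fourierMultiplierCLM ℂ (p i) u)) ≤
        C₁ * C₂ * B * sobolevNorm t u :=
  summable_of_sum_norm_le
    (mul_nonneg (mul_nonneg (mul_nonneg hC₁ hC₂) hB) (sobolevNorm_nonneg t u))
    (sum_norm_smul_multiplier_le hB hC₁ hC₂ hβ hγ hp hq hb hbB hloc h₁ h₂ hu)

end Sobolev

/-! ### Lipschitz functions -/

section Lipschitz

variable {E : Type*} [NormedAddCommGroup E] [InnerProductSpace ℝ E] [FiniteDimensional ℝ E]
  [MeasurableSpace E] [BorelSpace E]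

/-- A real Lipschitz function is absolutely continuous on every segment, and by Fubini almost every
segment in a given direction meets the set where the bound of the gradient fails in a null set. The
inequality thus holds for almost all `x`, and by continuity for all. -/
theorem abs_sub_le_of_ae_norm_fderiv_le {f : E → ℝ} {K : NNReal} (hf : LipschitzWith K f) {L : ℝ}
    (hL : ∀ᵐ x, ‖fderiv ℝ f x‖ ≤ L) (x v : E) : |f (x + v) - f x| ≤ L * ‖v‖ := by
  let P : E → Prop := fun x ↦ DifferentiableAt ℝ f x ∧ ‖fderiv ℝ f x‖ ≤ L
  have hPm : MeasurableSet {x | P x} :=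
    (measurableSet_of_differentiableAt ℝ f).inter
      (measurableSet_le (measurable_fderiv ℝ f).norm measurable_const)
  have hP : ∀ᵐ x, P x := by
    filter_upwards [hf.ae_differentiableAt, hL] with x h1 h2 using ⟨h1, h2⟩
  have h1 : ∀ t : ℝ, ∀ᵐ x : E, P (x + t • v) := fun t ↦
    (measurePreserving_add_right volume (t • v)).quasiMeasurePreserving.ae hP
  have h2 : ∀ᵐ x : E, ∀ᵐ t : ℝ, P (x + t • v) := by
    refine (Measure.ae_ae_comm ?_).mp (.of_forall h1)
    have : Measurable fun p : ℝ × E ↦ p.2 + p.1 • v := by fun_prop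
    exact this hPm
  have h3 : ∀ᵐ x : E, |f (x + v) - f x| ≤ L * ‖v‖ := by
    filter_upwards [h2] with x hx
    set g : ℝ → ℝ := fun t ↦ f (x + t • v) with hg
    have hgL : LipschitzWith (K * ‖v‖₊) g := by
      refine hf.comp (LipschitzWith.of_dist_le_mul fun s t ↦ ?_)
      rw [dist_add_left, dist_eq_norm, ← sub_smul, norm_smul, mul_comm, dist_eq_norm]
      rfl
    have hint := (hgL.lipschitzOnWith (s := Set.uIcc 0 1)).absolutelyContinuousOnInterval
      |>.integral_deriv_eq_sub
    have hgx : f (x + v) - f x = g 1 - g 0 := by simp [hg]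
    rw [hgx, ← hint, ← Real.norm_eq_abs]
    refine (intervalIntegral.norm_integral_le_of_norm_le_const_ae (C := L * ‖v‖) ?_).trans
      (by simp)
    filter_upwards [hx] with t ht _
    have hd : HasDerivAt g (fderiv ℝ f (x + t • v) v) t := by
      refine ht.1.hasFDerivAt.comp_hasDerivAt t ?_
      simpa using ((hasDerivAt_id t).smul_const v).const_add x
    rw [hd.deriv]
    exact (ContinuousLinearMap.le_opNorm _ _).trans (by gcongr; exact ht.2)
  have hclosed : IsClosed {x : E | |f (x + v) - f x| ≤ L * ‖v‖} := by
    have := hf.continuous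
    exact isClosed_le (by fun_prop) continuous_const
  have hd := Measure.dense_of_ae h3
  have hu := hclosed.closure_eq.symm.trans hd.closure_eq
  exact hu.symm.subset (Set.mem_univ x)

/-- A Lipschitz function is Lipschitz with constant the essential supremum of its gradient. -/
theorem norm_sub_le_of_ae_norm_fderiv_le {a : E → ℂ} {K : NNReal} (ha : LipschitzWith K a) {L : ℝ}
    (hL : ∀ᵐ x, ‖fderiv ℝ a x‖ ≤ L) (x y : E) : ‖a x - a y‖ ≤ L * ‖x - y‖ := by
  -- Rotating the values so that the increment is a nonnegative real number reduces to real values.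
  obtain ⟨c, hc, hcz⟩ : ∃ c : ℂ, ‖c‖ = 1 ∧ ‖a x - a y‖ = (c * (a x - a y)).re := by
    by_cases hz : a x - a y = 0
    · exact ⟨1, by simp, by simp [hz]⟩
    · refine ⟨(starRingEnd ℂ) (a x - a y) / ‖a x - a y‖, ?_, ?_⟩
      · rw [norm_div, RCLike.norm_conj]
        simp [hz]
      · have h : (‖a x - a y‖ : ℂ) ≠ 0 := by simpa using hz
        have : (starRingEnd ℂ) (a x - a y) / ‖a x - a y‖ * (a x - a y) = (‖a x - a y‖ : ℂ) := by
          rw [div_mul_eq_mul_div, mul_comm, Complex.mul_conj', sq]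
          field_simp
        rw [this, Complex.ofReal_re]
  let ℓ : ℂ →L[ℝ] ℝ := Complex.reCLM ∘L (ContinuousLinearMap.mul ℝ ℂ c)
  have hℓz : ∀ z, ℓ z = (c * z).re := fun z ↦ rfl
  have hℓ : ‖ℓ‖ ≤ 1 := ContinuousLinearMap.opNorm_le_bound _ zero_le_one fun z ↦ by
    rw [hℓz, Real.norm_eq_abs]
    exact (Complex.abs_re_le_norm _).trans (by rw [norm_mul, hc])
  have hf : LipschitzWith (‖ℓ‖₊ * K) (ℓ ∘ a) := ℓ.lipschitz.comp ha
  have hfL : ∀ᵐ x, ‖fderiv ℝ (ℓ ∘ a) x‖ ≤ L := by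
    filter_upwards [hL, ha.ae_differentiableAt] with x hx hd
    rw [(ℓ.hasFDerivAt.comp x hd.hasFDerivAt).fderiv]
    calc ‖ℓ ∘L fderiv ℝ a x‖ ≤ ‖ℓ‖ * ‖fderiv ℝ a x‖ := ContinuousLinearMap.opNorm_comp_le _ _
      _ ≤ 1 * ‖fderiv ℝ a x‖ := by gcongr
      _ ≤ L := by rwa [one_mul]
  have h := abs_sub_le_of_ae_norm_fderiv_le hf hfL y (x - y)
  rw [add_sub_cancel] at h
  rw [hcz]
  refine le_trans (le_of_eq ?_) ((le_abs_self _).trans h)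
  simp [hℓz, mul_sub]

end Lipschitz

/-! ### Convolution of a bounded function with a Schwartz function -/

section Convolution

universe u

variable {E F : Type u} [NormedAddCommGroup E] [InnerProductSpace ℝ E] [FiniteDimensional ℝ E]
  [MeasurableSpace E] [BorelSpace E] [NormedAddCommGroup F] [NormedSpace ℝ F] [NormedSpace ℂ F]
  [SMulCommClass ℝ ℂ F]

theorem norm_le_supNorm_ae {E : Type*} [NormedAddCommGroup E] [InnerProductSpace ℝ E]
    [FiniteDimensional ℝ E] [MeasurableSpace E] [BorelSpace E] {F : Type*} [NormedAddCommGroup F]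
    {a : E → F} (ha : MemLp a ⊤ volume) : ∀ᵐ x, ‖a x‖ ≤ supNorm a := by
  have := ae_le_lpNorm_exponent_top ha
  rwa [← toReal_eLpNorm ha.1] at this

theorem supNorm_nonneg {E : Type*} [NormedAddCommGroup E] [InnerProductSpace ℝ E]
    [FiniteDimensional ℝ E] [MeasurableSpace E] [BorelSpace E] {F : Type*} [NormedAddCommGroup F]
    (a : E → F) : 0 ≤ supNorm a := ENNReal.toReal_nonneg

theorem integrable_smul_comp_sub (K : 𝓢(E, F)) {a : E → ℂ} (ha : MemLp a ⊤ volume) (x : E) :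
    Integrable fun t ↦ a t • K (x - t) :=
  (K.integrable.comp_sub_left x).bdd_smul _ ha.1 (norm_le_supNorm_ae ha)

theorem norm_integral_smul_comp_sub_le (K : 𝓢(E, F)) {a : E → ℂ} (ha : MemLp a ⊤ volume) (x : E) :
    ‖∫ t, a t • K (x - t)‖ ≤ supNorm a * ∫ y, ‖K y‖ := by
  rw [← integral_sub_left_eq_self (fun y ↦ ‖K y‖) volume x, ← integral_const_mul]
  refine norm_integral_le_of_norm_le ((K.integrable.comp_sub_left x).norm.const_mul _) ?_
  filter_upwards [norm_le_supNorm_ae ha] with t ht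
  rw [norm_smul]
  gcongr

theorem exists_norm_le_one_add_norm_rpow (K : 𝓢(E, F)) (k : ℕ) :
    ∃ C, 0 ≤ C ∧ ∀ y, ‖K y‖ ≤ C * (1 + ‖y‖) ^ (-(k : ℝ)) := by
  have h := SchwartzMap.one_add_le_sup_seminorm_apply (𝕜 := ℝ) (m := (k, 0)) (k := k) (n := 0)
    le_rfl le_rfl K
  refine ⟨_, (by positivity : 0 ≤ 2 ^ k *
    ((Finset.Iic (k, 0)).sup fun m ↦ SchwartzMap.seminorm ℝ m.1 m.2) K), fun y ↦ ?_⟩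
  have := h y
  rw [norm_iteratedFDeriv_zero] at this
  rw [Real.rpow_neg (by positivity), Real.rpow_natCast, ← div_eq_mul_inv,
    le_div_iff₀ (by positivity), mul_comm]
  exact this

theorem hasFDerivAt_integral_smul_comp_sub (K : 𝓢(E, F)) {a : E → ℂ} (ha : MemLp a ⊤ volume)
    (x : E) : HasFDerivAt (fun x ↦ ∫ t, a t • K (x - t))
      (∫ t, a t • SchwartzMap.fderivCLM ℝ E F K (x - t)) x := by
  obtain ⟨C, hC0, hC⟩ := exists_norm_le_one_add_norm_rpow (SchwartzMap.fderivCLM ℝ E F K)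
    (Module.finrank ℝ E + 1)
  set r : ℝ := ((Module.finrank ℝ E + 1 : ℕ) : ℝ) with hr
  have hr0 : 0 ≤ r := by positivity
  refine hasFDerivAt_integral_of_dominated_of_fderiv_le (Metric.ball_mem_nhds x one_pos)
    (F' := fun x t ↦ a t • SchwartzMap.fderivCLM ℝ E F K (x - t))
    (bound := fun t ↦ supNorm a * (C * (2 ^ r * (1 + ‖x - t‖) ^ (-r))))
    (.of_forall fun y ↦ (integrable_smul_comp_sub K ha y).1) (integrable_smul_comp_sub K ha x)
    (integrable_smul_comp_sub _ ha x).1 ?_ ?_ ?_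
  · filter_upwards [norm_le_supNorm_ae ha] with t ht y hy
    rw [norm_smul]
    have h0 := supNorm_nonneg a
    gcongr
    refine (hC _).trans ?_
    gcongr
    have h1 : (1 + ‖x - t‖) / 2 ≤ 1 + ‖y - t‖ := by
      have : ‖x - t‖ ≤ ‖x - y‖ + ‖y - t‖ := norm_sub_le_norm_sub_add_norm_sub _ _ _
      rw [Metric.mem_ball, dist_comm, dist_eq_norm] at hy
      linarith [norm_nonneg (y - t)]
    calc (1 + ‖y - t‖) ^ (-r) ≤ ((1 + ‖x - t‖) / 2) ^ (-r) :=
          Real.rpow_le_rpow_of_nonpos (by positivity) h1 (by linarith)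
      _ = 2 ^ r * (1 + ‖x - t‖) ^ (-r) := by
        rw [Real.div_rpow (by positivity) (by positivity),
          Real.rpow_neg (by positivity : (0 : ℝ) ≤ 2), div_inv_eq_mul, mul_comm]
  · have := (integrable_one_add_norm (E := E) (μ := volume) (r := r)
      (by rw [hr]; push_cast; linarith)).comp_sub_left x
    exact ((this.const_mul _).const_mul _).const_mul _
  · refine .of_forall fun t y _ ↦ ?_
    have h1 : HasFDerivAt (fun y ↦ K (y - t)) (SchwartzMap.fderivCLM ℝ E F K (y - t)) y := by
      have := (K.differentiable (y - t)).hasFDerivAt.comp y (hasFDerivAt_sub_const t)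
      simpa [Function.comp_def] using this
    exact h1.const_smul (a t)

/-- The convolution of a bounded function with a Schwartz function is smooth, and all its
derivatives are bounded. -/
theorem hasTemperateGrowth_integral_smul_comp_sub (K : 𝓢(E, F)) {a : E → ℂ}
    (ha : MemLp a ⊤ volume) : (fun x ↦ ∫ t, a t • K (x - t)).HasTemperateGrowth := by
  -- The derivative is a convolution of the same kind, with values in another space; hence the
  -- inductions run over all target spaces at once.
  have hfd : ∀ {F : Type u} [NormedAddCommGroup F] [NormedSpace ℝ F] [NormedSpace ℂ F]
      [SMulCommClass ℝ ℂ F] (K : 𝓢(E, F)), fderiv ℝ (fun x ↦ ∫ t, a t • K (x - t)) =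
        fun x ↦ ∫ t, a t • SchwartzMap.fderivCLM ℝ E F K (x - t) := fun K ↦
    funext fun x ↦ (hasFDerivAt_integral_smul_comp_sub K ha x).fderiv
  have h1 : ∀ n : ℕ, ∀ {F : Type u} [NormedAddCommGroup F] [NormedSpace ℝ F] [NormedSpace ℂ F]
      [SMulCommClass ℝ ℂ F] (K : 𝓢(E, F)), ContDiff ℝ n (fun x ↦ ∫ t, a t • K (x - t)) := by
    intro n
    induction n with
    | zero =>
      intro F _ _ _ _ K
      refine contDiff_zero.mpr (continuous_iff_continuousAt.mpr fun x ↦ ?_)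
      exact (hasFDerivAt_integral_smul_comp_sub K ha x).continuousAt
    | succ n ih =>
      intro F _ _ _ _ K
      push_cast
      refine contDiff_succ_iff_fderiv.mpr
        ⟨fun x ↦ (hasFDerivAt_integral_smul_comp_sub K ha x).differentiableAt,
          fun h ↦ absurd h (by simp), ?_⟩
      rw [hfd]
      exact ih _
  have h2 : ∀ n : ℕ, ∀ {F : Type u} [NormedAddCommGroup F] [NormedSpace ℝ F] [NormedSpace ℂ F]
      [SMulCommClass ℝ ℂ F] (K : 𝓢(E, F)),
      ∃ C, ∀ x, ‖iteratedFDeriv ℝ n (fun x ↦ ∫ t, a t • K (x - t)) x‖ ≤ C := by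
    intro n
    induction n with
    | zero =>
      intro F _ _ _ _ K
      exact ⟨_, fun x ↦ by
        rw [norm_iteratedFDeriv_zero]; exact norm_integral_smul_comp_sub_le K ha x⟩
    | succ n ih =>
      intro F _ _ _ _ K
      obtain ⟨C, hC⟩ := ih (SchwartzMap.fderivCLM ℝ E F K)
      refine ⟨C, fun x ↦ ?_⟩
      rw [← norm_iteratedFDeriv_fderiv, hfd]
      exact hC x
  refine ⟨contDiff_infty.mpr fun n ↦ h1 n K, fun n ↦ ?_⟩
  obtain ⟨C, hC⟩ := h2 n K
  exact ⟨0, C, fun x ↦ by simpa using hC x⟩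

end Convolution

/-! ### The symbols and their convolution kernels -/

section Symbol

variable {E : Type*} [NormedAddCommGroup E] [InnerProductSpace ℝ E] [FiniteDimensional ℝ E]
  [MeasurableSpace E] [BorelSpace E] {χ : ℝ → ℝ}

theorem symbol_eq_one (hχ : IsCutoff χ) {k : ℤ} {η : E}
    (h : 2 * Real.pi * ‖η‖ ≤ 11 / 10 * 2 ^ k) : symbol χ k η = 1 := by
  rw [symbol, hχ.eq_one, Complex.ofReal_one]
  rw [abs_of_nonneg (by positivity), zpow_neg, inv_mul_le_iff₀ (by positivity),
    mul_comm (2 ^ k : ℝ)]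
  exact h

theorem symbol_eq_zero (hχ : IsCutoff χ) {k : ℤ} {η : E}
    (h : 19 / 10 * 2 ^ k ≤ 2 * Real.pi * ‖η‖) : symbol χ k η = 0 := by
  rw [symbol, hχ.eq_zero, Complex.ofReal_zero]
  rw [abs_of_nonneg (by positivity), zpow_neg, le_inv_mul_iff₀ (by positivity),
    mul_comm (2 ^ k : ℝ)]
  exact h

theorem lt_of_symbol_ne_zero (hχ : IsCutoff χ) {k : ℤ} {η : E} (h : symbol χ k η ≠ 0) :
    2 * Real.pi * ‖η‖ < 19 / 10 * 2 ^ k :=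
  not_le.mp fun h' ↦ h (symbol_eq_zero hχ h')

theorem norm_symbol_le_one (hχ : IsCutoff χ) (k : ℤ) (η : E) : ‖symbol χ k η‖ ≤ 1 := by
  rw [symbol, Complex.norm_real, Real.norm_of_nonneg (hχ.nonneg _)]
  exact hχ.le_one _

theorem symbol_zero_right (hχ : IsCutoff χ) (k : ℤ) : symbol χ k (0 : E) = 1 :=
  symbol_eq_one hχ (by simp; positivity)

theorem symbol_eq_symbol_zero (χ : ℝ → ℝ) (k : ℤ) (η : E) :
    symbol χ k η = symbol χ 0 (((2 : ℝ) ^ (-k)) • η) := by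
  simp only [symbol, norm_smul, neg_zero, zpow_zero, one_mul]
  rw [Real.norm_of_nonneg (by positivity)]
  congr 2
  ring

/-- The symbols are smooth at the origin because they are constant near it. -/
theorem contDiff_symbol (hχ : IsCutoff χ) (k : ℤ) : ContDiff ℝ ∞ (symbol χ k : E → ℂ) := by
  refine contDiff_iff_contDiffAt.mpr fun η ↦ ?_
  by_cases hη : η = 0
  · have hU : IsOpen {ξ : E | 2 * Real.pi * ‖ξ‖ < 11 / 10 * 2 ^ k} :=
      isOpen_lt (by fun_prop) continuous_const
    have : (symbol χ k : E → ℂ) =ᶠ[nhds η] fun _ ↦ 1 := by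
      filter_upwards [hU.mem_nhds (by subst hη; simp; positivity)] with ξ hξ
      exact symbol_eq_one hχ hξ.le
    exact contDiffAt_const.congr_of_eventuallyEq this
  · have h1 : ContDiffAt ℝ ∞ (fun ξ : E ↦ (2 : ℝ) ^ (-k) * (2 * Real.pi * ‖ξ‖)) η :=
      contDiffAt_const.mul (contDiffAt_const.mul (contDiffAt_norm ℝ hη))
    exact Complex.ofRealCLM.contDiff.contDiffAt.comp η (hχ.smooth.contDiffAt.comp η h1)

theorem hasCompactSupport_symbol (hχ : IsCutoff χ) (k : ℤ) :
    HasCompactSupport (symbol χ k : E → ℂ) := by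
  refine HasCompactSupport.intro (isCompact_closedBall (0 : E) (19 / 10 * 2 ^ k)) fun η hη ↦ ?_
  refine symbol_eq_zero hχ ?_
  rw [mem_closedBall_zero_iff, not_le] at hη
  refine hη.le.trans (le_mul_of_one_le_left (norm_nonneg η) ?_)
  linarith [Real.pi_gt_three]

theorem hasTemperateGrowth_symbol (hχ : IsCutoff χ) (k : ℤ) :
    (symbol χ k : E → ℂ).HasTemperateGrowth :=
  (hasCompactSupport_symbol hχ k).hasTemperateGrowth (contDiff_symbol hχ k)

/-- The convolution kernel of `S_k` as a Schwartz function. -/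
noncomputable def kernelSchwartz (hχ : IsCutoff χ) (k : ℤ) : 𝓢(E, ℂ) :=
  𝓕⁻ ((hasCompactSupport_symbol hχ k).toSchwartzMap (contDiff_symbol hχ k) : 𝓢(E, ℂ))

theorem coe_kernelSchwartz (hχ : IsCutoff χ) (k : ℤ) :
    (kernelSchwartz hχ k : E → ℂ) = kernel χ k := by
  rw [kernelSchwartz, SchwartzMap.fourierInv_coe]
  rfl

theorem kernel_apply (χ : ℝ → ℝ) (k : ℤ) (x : E) :
    kernel χ k x = ∫ η : E, (Real.fourierChar (inner ℝ η x) : ℂ) * symbol χ k η := by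
  rw [kernel, Real.fourierInv_eq]
  simp [Circle.smul_def]

/-- The kernels are dilates of each other. -/
theorem kernel_eq_dilate (χ : ℝ → ℝ) (k : ℤ) (x : E) :
    kernel χ k x = ((((2 : ℝ) ^ k) ^ Module.finrank ℝ E : ℝ) : ℂ) *
      kernel χ 0 (((2 : ℝ) ^ k) • x) := by
  rw [kernel_apply, kernel_apply]
  have h2 : (2 : ℝ) ^ k ≠ 0 := by positivity
  have h := Measure.integral_comp_smul_of_nonneg (volume : Measure E)
    (fun η ↦ (Real.fourierChar (inner ℝ η (((2 : ℝ) ^ k) • x)) : ℂ) * symbol χ 0 η)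
    ((2 : ℝ) ^ (-k)) (hR := by positivity)
  rw [← Complex.real_smul, zpow_neg, inv_pow, inv_inv] at *
  rw [← h]
  refine integral_congr_ae (.of_forall fun η ↦ ?_)
  simp only
  rw [symbol_eq_symbol_zero, real_inner_smul_left, real_inner_smul_right, zpow_neg,
    inv_mul_cancel_left₀ h2]

theorem integral_norm_kernel (χ : ℝ → ℝ) (k : ℤ) :
    ∫ x : E, ‖kernel χ k x‖ = ∫ x : E, ‖kernel χ 0 x‖ := by
  have h := Measure.integral_comp_smul_of_nonneg (volume : Measure E)
    (fun x ↦ ‖kernel χ 0 x‖) ((2 : ℝ) ^ k) (hR := by positivity)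
  have h2 : ((2 : ℝ) ^ k) ^ Module.finrank ℝ E ≠ 0 := by positivity
  simp_rw [kernel_eq_dilate χ k, norm_mul, Complex.norm_real]
  rw [integral_const_mul, h, Real.norm_of_nonneg (by positivity), smul_eq_mul,
    mul_inv_cancel_left₀ h2]

theorem integral_norm_kernel_mul_norm (χ : ℝ → ℝ) (k : ℤ) :
    ∫ x : E, ‖kernel χ k x‖ * ‖x‖ = 2 ^ (-k) * ∫ x : E, ‖kernel χ 0 x‖ * ‖x‖ := by
  have h := Measure.integral_comp_smul_of_nonneg (volume : Measure E)
    (fun x ↦ ‖kernel χ 0 x‖ * ‖x‖) ((2 : ℝ) ^ k) (hR := by positivity)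
  have h2 : ((2 : ℝ) ^ k) ^ Module.finrank ℝ E ≠ 0 := by positivity
  have h3 : (2 : ℝ) ^ k ≠ 0 := by positivity
  rw [smul_eq_mul] at h
  have e : ∀ x : E, ‖kernel χ k x‖ * ‖x‖ = 2 ^ (-k) * (((2 : ℝ) ^ k) ^ Module.finrank ℝ E *
      (‖kernel χ 0 (((2 : ℝ) ^ k) • x)‖ * ‖((2 : ℝ) ^ k) • x‖)) := fun x ↦ by
    rw [kernel_eq_dilate χ k, norm_mul, Complex.norm_real, norm_smul,
      Real.norm_of_nonneg (by positivity), Real.norm_of_nonneg (by positivity), zpow_neg]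
    field_simp
  simp_rw [e]
  rw [integral_const_mul, integral_const_mul, h, mul_inv_cancel_left₀ h2]

theorem integral_kernel (hχ : IsCutoff χ) (k : ℤ) : ∫ x : E, kernel χ k x = 1 := by
  have h : (𝓕 (kernelSchwartz hχ k : 𝓢(E, ℂ)) : 𝓢(E, ℂ)) 0 = 1 := by
    rw [kernelSchwartz, fourier_fourierInv_eq]
    exact symbol_zero_right hχ k
  rw [SchwartzMap.fourier_coe, Real.fourier_eq, coe_kernelSchwartz] at h
  simpa using h

theorem integrable_kernel_mul_norm (hχ : IsCutoff χ) (k : ℤ) :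
    Integrable fun x : E ↦ ‖kernel χ k x‖ * ‖x‖ := by
  rw [← coe_kernelSchwartz hχ]
  have := (kernelSchwartz (E := E) hχ k).integrable_pow_mul volume 1
  simpa [mul_comm] using this

end Symbol

/-! ### Low frequency parts of bounded functions -/

section LowFreqFun

variable {E : Type} [NormedAddCommGroup E] [InnerProductSpace ℝ E] [FiniteDimensional ℝ E]
  [MeasurableSpace E] [BorelSpace E] {χ : ℝ → ℝ} {a : E → ℂ}

theorem lowFreqFun_of_neg (χ : ℝ → ℝ) {k : ℤ} (hk : k < 0) (a : E → ℂ) :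
    lowFreqFun χ k a = 0 := by
  rw [lowFreqFun, if_pos hk]

theorem lowFreqFun_apply (hχ : IsCutoff χ) {k : ℤ} (hk : 0 ≤ k) (a : E → ℂ) (x : E) :
    lowFreqFun χ k a x = ∫ t, a t • kernelSchwartz hχ k (x - t) := by
  rw [lowFreqFun, if_neg hk.not_gt, coe_kernelSchwartz, convolution_def,
    ← integral_sub_left_eq_self _ volume x]
  simp [mul_comm]

theorem hasTemperateGrowth_lowFreqFun (hχ : IsCutoff χ) (k : ℤ) (ha : MemLp a ⊤ volume) :
    (lowFreqFun χ k a).HasTemperateGrowth := by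
  rcases lt_or_ge k 0 with hk | hk
  · rw [lowFreqFun_of_neg χ hk]
    exact Function.HasTemperateGrowth.zero
  · rw [funext (lowFreqFun_apply hχ hk a)]
    exact hasTemperateGrowth_integral_smul_comp_sub _ ha

theorem norm_lowFreqFun_le (hχ : IsCutoff χ) (k : ℤ) (ha : MemLp a ⊤ volume) (x : E) :
    ‖lowFreqFun χ k a x‖ ≤ supNorm a * ∫ y : E, ‖kernel χ 0 y‖ := by
  rcases lt_or_ge k 0 with hk | hk
  · rw [lowFreqFun_of_neg χ hk, Pi.zero_apply, norm_zero]
    exact mul_nonneg (supNorm_nonneg a) (integral_nonneg fun _ ↦ norm_nonneg _)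
  · rw [lowFreqFun_apply hχ hk, ← integral_norm_kernel χ k, ← coe_kernelSchwartz hχ]
    exact norm_integral_smul_comp_sub_le _ ha x

/-- The low frequency parts of a Lipschitz function converge to it at the rate `2 ^ (-k)`, because
the kernel has integral one and is concentrated at the scale `2 ^ (-k)`. -/
theorem norm_lowFreqFun_sub_le (hχ : IsCutoff χ) {k : ℤ} (hk : 0 ≤ k) (ha : MemLp a ⊤ volume)
    {L : ℝ} (hL : ∀ x y, ‖a x - a y‖ ≤ L * ‖x - y‖) (x : E) :
    ‖lowFreqFun χ k a x - a x‖ ≤ L * (2 ^ (-k) * ∫ y : E, ‖kernel χ 0 y‖ * ‖y‖) := by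
  have h1 : lowFreqFun χ k a x = ∫ t, a (x - t) * kernel χ k t := by
    rw [lowFreqFun_apply hχ hk, ← integral_sub_left_eq_self _ volume x]
    simp [coe_kernelSchwartz]
  have h2 : a x = ∫ t : E, a x * kernel χ k t := by
    rw [integral_const_mul, integral_kernel hχ, mul_one]
  have hi : Integrable fun t ↦ a (x - t) * kernel χ k t := by
    have := (integrable_smul_comp_sub (kernelSchwartz hχ k) ha x).comp_sub_left x
    simpa [coe_kernelSchwartz] using this
  have hi' : Integrable fun t : E ↦ a x * kernel χ k t := by
    have := (kernelSchwartz (E := E) hχ k).integrable (μ := volume)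
    rw [coe_kernelSchwartz hχ] at this
    exact this.const_mul _
  conv_lhs => rw [h1, h2]
  rw [← integral_sub hi hi', ← integral_norm_kernel_mul_norm, ← integral_const_mul]
  refine norm_integral_le_of_norm_le ((integrable_kernel_mul_norm hχ k).const_mul _)
    (.of_forall fun t ↦ ?_)
  rw [← sub_mul, norm_mul]
  have := hL (x - t) x
  rw [sub_sub_cancel_left, norm_neg] at this
  calc _ ≤ L * ‖t‖ * ‖kernel χ k t‖ := by gcongr
    _ = _ := by ring

/-- The Fourier transform of `S_k a * g` at a point only involves the Fourier transform of `g` at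
the translates of this point by the support of the symbol of `S_k`. As `a` is only bounded, its own
Fourier transform is not a function; the kernel is expanded into plane waves instead, and Fubini's
theorem is applied twice. -/
theorem fourierInv_lowFreqFun_smul_eq_zero (hχ : IsCutoff χ) (k : ℤ) (ha : MemLp a ⊤ volume)
    (g : 𝓢(E, ℂ)) (ξ : E)
    (h : ∀ ζ, symbol χ k ζ ≠ 0 → (𝓕⁻ g : 𝓢(E, ℂ)) (ξ + ζ) = 0) :
    (𝓕⁻ (SchwartzMap.smulLeftCLM ℂ (lowFreqFun χ k a) g) : 𝓢(E, ℂ)) ξ = 0 := by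
  have hb := hasTemperateGrowth_lowFreqFun hχ k ha
  rw [SchwartzMap.fourierInv_coe, Real.fourierInv_eq]
  simp only [SchwartzMap.smulLeftCLM_apply_apply hb, Circle.smul_def, smul_eq_mul]
  rcases lt_or_ge k 0 with hk | hk
  · simp [lowFreqFun_of_neg χ hk]
  set K : 𝓢(E, ℂ) := kernelSchwartz hχ k with hK
  let e : E → E → ℂ := fun x ξ ↦ (Real.fourierChar (inner ℝ x ξ) : ℂ)
  have he : ∀ x ξ, ‖e x ξ‖ = 1 := fun x ξ ↦ Circle.norm_coe _
  have hec : Continuous fun p : E × E ↦ e p.1 p.2 :=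
    continuous_subtype_val.comp (Real.continuous_fourierChar.comp continuous_inner)
  have hec' : ∀ ξ, Continuous fun x ↦ e x ξ := fun ξ ↦ hec.comp (by fun_prop : Continuous (·, ξ))
  have inner0 : ∀ y, ∫ x, e x ξ * (K (x - y) * g x) = 0 := by
    intro y
    have hσ : Integrable (symbol χ k : E → ℂ) :=
      (contDiff_symbol hχ k).continuous.integrable_of_hasCompactSupport
        (hasCompactSupport_symbol hχ k)
    have h1 : ∀ x, e x ξ * (K (x - y) * g x) =
        ∫ ζ, (e (x - y) ζ * e x ξ) * (g x * symbol χ k ζ) := fun x ↦ by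
      rw [hK, coe_kernelSchwartz, kernel_apply, ← integral_mul_const, ← integral_const_mul]
      refine integral_congr_ae (.of_forall fun ζ ↦ ?_)
      simp only [e]
      rw [real_inner_comm ζ]
      ring
    simp_rw [h1]
    rw [integral_integral_swap]
    · have h2 : ∀ ζ, ∫ x, (e (x - y) ζ * e x ξ) * (g x * symbol χ k ζ) = 0 := fun ζ ↦ by
        by_cases hζ : symbol χ k ζ = 0
        · simp [hζ]
        have h3 : ∀ x, (e (x - y) ζ * e x ξ) * (g x * symbol χ k ζ) =
            (e (-y) ζ * symbol χ k ζ) * (e x (ξ + ζ) * g x) := fun x ↦ by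
          have : e (x - y) ζ * e x ξ = e (-y) ζ * e x (ξ + ζ) := by
            simp only [e, ← Circle.coe_mul, ← AddChar.map_add_eq_mul]
            congr 2
            simp only [sub_eq_add_neg, inner_add_left, inner_add_right]
            ring
          rw [this]; ring
        have h4 := h ζ hζ
        rw [SchwartzMap.fourierInv_coe, Real.fourierInv_eq] at h4
        simp only [Circle.smul_def, smul_eq_mul] at h4
        simp_rw [h3]
        rw [integral_const_mul]
        simp only [e]
        rw [h4, mul_zero]
      simp [h2]
    · refine (g.integrable.mul_prod hσ).bdd_mul (c := 1) ?_ (.of_forall fun p ↦ ?_)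
      · refine Continuous.aestronglyMeasurable ?_
        exact (hec.comp (by fun_prop : Continuous fun p : E × E ↦ (p.1 - y, p.2))).mul
          ((hec' ξ).comp continuous_fst)
      · rw [norm_mul, he, he, one_mul]
  have h5 : ∀ x, e x ξ * (lowFreqFun χ k a x * g x) =
      ∫ y, (a y * e x ξ) * (g x * K (x - y)) := fun x ↦ by
    rw [lowFreqFun_apply hχ hk, ← integral_mul_const, ← integral_const_mul]
    refine integral_congr_ae (.of_forall fun y ↦ ?_)
    simp only [smul_eq_mul, hK]
    ring
  change ∫ x, e x ξ * (lowFreqFun χ k a x * g x) = 0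
  simp_rw [h5]
  rw [integral_integral_swap]
  · have h6 : ∀ y, ∫ x, (a y * e x ξ) * (g x * K (x - y)) = 0 := fun y ↦ by
      have : ∀ x, (a y * e x ξ) * (g x * K (x - y)) = a y * (e x ξ * (K (x - y) * g x)) :=
        fun x ↦ by ring
      simp_rw [this]
      rw [integral_const_mul, inner0, mul_zero]
    simp [h6]
  · have hi : Integrable (fun p : E × E ↦ g p.1 * K (p.1 - p.2)) (volume.prod volume) := by
      have h7 : Integrable (fun p : E × E ↦ g p.2 * K (-(p.1 - p.2))) (volume.prod volume) :=
        g.integrable.convolution_integrand (ContinuousLinearMap.mul ℝ ℂ) K.integrable.comp_neg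
      simpa [Function.comp_def] using h7.swap
    refine hi.bdd_mul (c := supNorm a) ?_ ?_
    · exact ha.1.comp_snd.mul ((hec' ξ).comp continuous_fst).aestronglyMeasurable
    · have h8 : ∀ᵐ p : E × E ∂(volume.prod volume), ‖a p.2‖ ≤ supNorm a :=
        Measure.quasiMeasurePreserving_snd.ae (norm_le_supNorm_ae ha)
      filter_upwards [h8] with p hp
      rwa [norm_mul, he, mul_one]

end LowFreqFun

/-! ### Overlap of the dyadic frequency regions -/

section Overlap

variable {E : Type*} [NormedAddCommGroup E] [InnerProductSpace ℝ E] [FiniteDimensional ℝ E]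
  [MeasurableSpace E] [BorelSpace E] {χ : ℝ → ℝ}

theorem rpow_le_of_comparable {X Y A : ℝ} (hX : 0 < X) (hY : 0 < Y) (hA : 1 ≤ A) (h1 : X ≤ A * Y)
    (h2 : Y ≤ A * X) (t : ℝ) : X ^ t ≤ A ^ |t| * Y ^ t := by
  have hA0 : 0 < A := by linarith
  rcases le_total 0 t with ht | ht
  · rw [abs_of_nonneg ht, ← Real.mul_rpow hA0.le hY.le]
    exact Real.rpow_le_rpow hX.le h1 ht
  · rw [abs_of_nonpos ht, Real.rpow_neg hA0.le, mul_comm, ← div_eq_mul_inv,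
      ← Real.div_rpow hY.le hA0.le]
    exact Real.rpow_le_rpow_of_nonpos (by positivity)
      ((div_le_iff₀ hA0).mpr (by linarith)) ht

theorem sum_range_sub_four (f : ℕ → ℝ) (N : ℕ) : ∑ j ∈ Finset.range N, (f (j + 4) - f j) =
    f N + f (N + 1) + f (N + 2) + f (N + 3) - (f 0 + f 1 + f 2 + f 3) := by
  induction N with
  | zero => simp
  | succ N ih => rw [Finset.sum_range_succ, ih]; ring_nf

theorem sum_pow_le_of_pow_le {r c : ℝ} (hr : 0 < r) (hr1 : r < 1) (hc : 0 ≤ c) (T : Finset ℕ)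
    (h : ∀ k ∈ T, r ^ k ≤ c) : ∑ k ∈ T, r ^ k ≤ c / (1 - r) := by
  have h1r : 0 < 1 - r := by linarith
  rcases T.eq_empty_or_nonempty with rfl | hT
  · simp only [Finset.sum_empty]; positivity
  set k₀ := T.min' hT
  have hinj : Set.InjOn (fun k ↦ k - k₀) T := fun k hk l hl hkl ↦ by
    have h1 : k₀ ≤ k := T.min'_le k hk
    have h2 : k₀ ≤ l := T.min'_le l hl
    simp only at hkl
    omega
  have h1 : ∑ k ∈ T, r ^ k = r ^ k₀ * ∑ i ∈ T.image (fun k ↦ k - k₀), r ^ i := by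
    rw [Finset.sum_image hinj, Finset.mul_sum]
    refine Finset.sum_congr rfl fun k hk ↦ ?_
    rw [← pow_add, Nat.add_sub_cancel' (T.min'_le k hk)]
  have h2 : ∑ i ∈ T.image (fun k ↦ k - k₀), r ^ i ≤ (1 - r)⁻¹ := by
    rw [← tsum_geometric_of_lt_one hr.le hr1]
    exact (summable_geometric_of_lt_one hr.le hr1).sum_le_tsum _ fun i _ ↦ by positivity
  rw [h1, div_eq_mul_inv]
  gcongr
  exact h k₀ (T.min'_mem hT)

theorem symbol_add_eq_one (hχ : IsCutoff χ) {k : ℤ} {A B : ℝ} {ξ ζ : E}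
    (hξ : 2 * Real.pi * ‖ξ‖ ≤ A) (hζ : 2 * Real.pi * ‖ζ‖ ≤ B) (h : A + B ≤ 11 / 10 * 2 ^ k) :
    symbol χ k (ξ + ζ) = 1 := by
  refine symbol_eq_one hχ (le_trans ?_ h)
  have : 2 * Real.pi * ‖ξ + ζ‖ ≤ 2 * Real.pi * (‖ξ‖ + ‖ζ‖) := by gcongr; exact norm_add_le _ _
  linarith

/-- The symbol of `S_{k+1} - S_{k-3}`, which is `1` on a neighborhood of the support of the symbol
of `Δ_k`. -/
noncomputable def fatSymbol (χ : ℝ → ℝ) (k : ℤ) (ξ : E) : ℂ :=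
  symbol χ (k + 1) ξ - symbol χ (k - 3) ξ

/-- The symbol of the Littlewood-Paley block `Δ_k`, for `k ≥ 1`. -/
noncomputable def blockSymbol (χ : ℝ → ℝ) (k : ℤ) (ξ : E) : ℂ :=
  symbol χ k ξ - symbol χ (k - 1) ξ

theorem hasTemperateGrowth_fatSymbol (hχ : IsCutoff χ) (k : ℤ) :
    (fatSymbol χ k : E → ℂ).HasTemperateGrowth :=
  (hasTemperateGrowth_symbol hχ _).sub (hasTemperateGrowth_symbol hχ _)

theorem hasTemperateGrowth_blockSymbol (hχ : IsCutoff χ) (k : ℤ) :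
    (blockSymbol χ k : E → ℂ).HasTemperateGrowth :=
  (hasTemperateGrowth_symbol hχ _).sub (hasTemperateGrowth_symbol hχ _)

theorem lt_of_blockSymbol_ne_zero (hχ : IsCutoff χ) {k : ℤ} {ξ : E} (h : blockSymbol χ k ξ ≠ 0) :
    11 / 20 * 2 ^ k < 2 * Real.pi * ‖ξ‖ ∧ 2 * Real.pi * ‖ξ‖ < 19 / 10 * 2 ^ k := by
  have e : (2 : ℝ) ^ (k - 1) = 2 ^ k / 2 := by rw [zpow_sub_one₀ two_ne_zero]; ring
  have hk : (0 : ℝ) < 2 ^ k := by positivity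
  constructor
  · by_contra! hle
    refine h ?_
    rw [blockSymbol, symbol_eq_one hχ (by linarith), symbol_eq_one hχ (by rw [e]; linarith),
      sub_self]
  · by_contra! hle
    refine h ?_
    rw [blockSymbol, symbol_eq_zero hχ hle, symbol_eq_zero hχ (by rw [e]; linarith), sub_self]

theorem lt_of_fatSymbol_ne_zero (hχ : IsCutoff χ) {k : ℤ} {ξ : E} (h : fatSymbol χ k ξ ≠ 0) :
    11 / 80 * 2 ^ k < 2 * Real.pi * ‖ξ‖ ∧ 2 * Real.pi * ‖ξ‖ < 38 / 10 * 2 ^ k := by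
  have e : (2 : ℝ) ^ (k + 1) = 2 * 2 ^ k := by rw [zpow_add_one₀ two_ne_zero]; ring
  have e' : (2 : ℝ) ^ (k - 3) = 2 ^ k / 8 := by
    rw [zpow_sub₀ two_ne_zero]; norm_num
  have hk : (0 : ℝ) < 2 ^ k := by positivity
  constructor
  · by_contra! hle
    refine h ?_
    rw [fatSymbol, symbol_eq_one hχ (by rw [e]; linarith), symbol_eq_one hχ (by rw [e']; linarith),
      sub_self]
  · by_contra! hle
    refine h ?_
    rw [fatSymbol, symbol_eq_zero hχ (by rw [e]; linarith),
      symbol_eq_zero hχ (by rw [e']; linarith), sub_self]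

theorem fatSymbol_eq_one (hχ : IsCutoff χ) {k : ℤ} {ξ : E}
    (h : 19 / 80 * 2 ^ k ≤ 2 * Real.pi * ‖ξ‖) (h' : 2 * Real.pi * ‖ξ‖ ≤ 11 / 5 * 2 ^ k) :
    fatSymbol χ k ξ = 1 := by
  have e : (2 : ℝ) ^ (k + 1) = 2 * 2 ^ k := by rw [zpow_add_one₀ two_ne_zero]; ring
  have e' : (2 : ℝ) ^ (k - 3) = 2 ^ k / 8 := by
    rw [zpow_sub₀ two_ne_zero]; norm_num
  rw [fatSymbol, symbol_eq_one hχ (by rw [e]; linarith), symbol_eq_zero hχ (by rw [e']; linarith),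
    sub_zero]

/-- The difference of the two cut-offs is nonnegative, since the larger one is `1` wherever the
smaller one is nonzero; monotonicity of `χ` is not needed. -/
theorem norm_fatSymbol (hχ : IsCutoff χ) (k : ℤ) (ξ : E) :
    ‖fatSymbol χ k ξ‖ = ‖symbol χ (k + 1) ξ‖ - ‖symbol χ (k - 3) ξ‖ := by
  by_cases h : symbol χ (k - 3) ξ = 0
  · simp [fatSymbol, h]
  · have e : (2 : ℝ) ^ (k + 1) = 16 * 2 ^ (k - 3) := by
      rw [show k + 1 = (k - 3) + 4 by ring, zpow_add₀ two_ne_zero]; norm_num; ring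
    have hk : (0 : ℝ) < 2 ^ (k - 3) := by positivity
    have h1 : symbol χ (k + 1) ξ = 1 :=
      symbol_eq_one hχ (by rw [e]; linarith [lt_of_symbol_ne_zero hχ h])
    rw [fatSymbol, h1, norm_one, symbol, ← Complex.ofReal_one, ← Complex.ofReal_sub,
      Complex.norm_real, Complex.norm_real, Real.norm_of_nonneg (hχ.nonneg _),
      Real.norm_of_nonneg (sub_nonneg.mpr (hχ.le_one _))]

theorem norm_blockSymbol_le (hχ : IsCutoff χ) (k : ℤ) (ξ : E) :
    ‖blockSymbol χ k ξ‖ ≤ ‖fatSymbol χ k ξ‖ := by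
  by_cases h : blockSymbol χ k ξ = 0
  · simp [h]
  obtain ⟨h1, h2⟩ := lt_of_blockSymbol_ne_zero hχ h
  have hk : (0 : ℝ) < 2 ^ k := by positivity
  rw [fatSymbol_eq_one hχ (by linarith) (by linarith), norm_one, blockSymbol, symbol, symbol,
    ← Complex.ofReal_sub, Complex.norm_real, Real.norm_eq_abs]
  exact abs_sub_le_of_nonneg_of_le (hχ.nonneg _) (hχ.le_one _) (hχ.nonneg _) (hχ.le_one _)

/-- On the support of each symbol the dyadic weight is comparable to the Bessel weight, and the sum
of the symbols telescopes to at most `4`. -/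
theorem exists_sum_sq_fatSymbol_le (hχ : IsCutoff χ) (m : ℕ) (t : ℝ) :
    ∃ C, 0 ≤ C ∧ ∀ (S : Finset ℕ) (ξ : E),
      ∑ j ∈ S, (((2 : ℝ) ^ (j + (m + 2))) ^ t * ‖fatSymbol χ ((j + (m + 2) : ℕ) : ℤ) ξ‖) ^ 2 ≤
        C ^ 2 * (1 + ‖ξ‖ ^ 2) ^ t := by
  -- `A` is a crude bound for the ratio of `4 ^ k` and `1 + |ξ| ^ 2` on the support of the symbol.
  set A : ℝ := 10 ^ 4 with hA
  refine ⟨√(4 * A ^ |t|), Real.sqrt_nonneg _, fun S ξ ↦ ?_⟩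
  rw [Real.sq_sqrt (by positivity)]
  set Y : ℝ := 1 + ‖ξ‖ ^ 2 with hY
  have hY0 : 0 < Y := by positivity
  have term : ∀ j : ℕ, (((2 : ℝ) ^ (j + (m + 2))) ^ t *
      ‖fatSymbol χ ((j + (m + 2) : ℕ) : ℤ) ξ‖) ^ 2 ≤
        A ^ |t| * Y ^ t * ‖fatSymbol χ ((j + (m + 2) : ℕ) : ℤ) ξ‖ := by
    intro j
    set k : ℕ := j + (m + 2)
    by_cases h : fatSymbol χ (k : ℤ) ξ = 0
    · simp [h]
    obtain ⟨h1, h2⟩ := lt_of_fatSymbol_ne_zero hχ h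
    rw [zpow_natCast] at h1 h2
    have hx1 : (1 : ℝ) ≤ 2 ^ k := one_le_pow₀ one_le_two
    set x : ℝ := 2 ^ k
    have hn := norm_nonneg ξ
    have hpi := Real.pi_gt_three
    have hpi' := Real.pi_lt_four
    have h3 : x ^ 2 ≤ A * Y := by
      have : x ≤ 100 * ‖ξ‖ := by nlinarith
      rw [hA, hY]
      nlinarith
    have h4 : Y ≤ A * x ^ 2 := by
      have : ‖ξ‖ ≤ x := by nlinarith
      rw [hA, hY]
      nlinarith
    have h5 : (x ^ t) ^ 2 = (x ^ 2) ^ t := by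
      rw [← Real.rpow_natCast, ← Real.rpow_mul (by positivity), mul_comm,
        Real.rpow_mul (by positivity), Real.rpow_natCast]
    have h6 : ‖fatSymbol χ (k : ℤ) ξ‖ ≤ 1 := by
      rw [norm_fatSymbol hχ]
      linarith [norm_symbol_le_one hχ ((k : ℤ) + 1) ξ, norm_nonneg (symbol χ ((k : ℤ) - 3) ξ)]
    rw [mul_pow, h5]
    have h7 := rpow_le_of_comparable (by positivity) hY0 (by rw [hA]; norm_num) h3 h4 t
    have h8 : ‖fatSymbol χ (k : ℤ) ξ‖ ^ 2 ≤ ‖fatSymbol χ (k : ℤ) ξ‖ := by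
      nlinarith [norm_nonneg (fatSymbol χ (k : ℤ) ξ)]
    gcongr
  have tele : ∑ j ∈ S, ‖fatSymbol χ ((j + (m + 2) : ℕ) : ℤ) ξ‖ ≤ 4 := by
    obtain ⟨N, hN⟩ := S.exists_nat_subset_range
    refine (Finset.sum_le_sum_of_subset_of_nonneg hN fun _ _ _ ↦ norm_nonneg _).trans ?_
    set f : ℕ → ℝ := fun j ↦ ‖symbol χ ((j : ℤ) + m - 1) ξ‖ with hf
    have e : ∀ j : ℕ, ‖fatSymbol χ ((j + (m + 2) : ℕ) : ℤ) ξ‖ = f (j + 4) - f j := fun j ↦ by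
      rw [norm_fatSymbol hχ, hf]
      push_cast
      ring_nf
    simp_rw [e]
    rw [sum_range_sub_four]
    have h0 : ∀ j, 0 ≤ f j := fun j ↦ norm_nonneg _
    have h1 : ∀ j, f j ≤ 1 := fun j ↦ norm_symbol_le_one hχ _ _
    linarith [h0 0, h0 1, h0 2, h0 3, h1 N, h1 (N + 1), h1 (N + 2), h1 (N + 3)]
  calc _ ≤ ∑ j ∈ S, A ^ |t| * Y ^ t * ‖fatSymbol χ ((j + (m + 2) : ℕ) : ℤ) ξ‖ :=
        Finset.sum_le_sum fun j _ ↦ term j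
    _ = A ^ |t| * Y ^ t * ∑ j ∈ S, ‖fatSymbol χ ((j + (m + 2) : ℕ) : ℤ) ξ‖ := by
        rw [Finset.mul_sum]
    _ ≤ A ^ |t| * Y ^ t * 4 := by gcongr
    _ = _ := by ring

/-- At a frequency `ξ` only the terms with `2 ^ k` at least of the order of `|ξ|` are nonzero; for a
negative power of `2 ^ k` their sum is geometric, and comparable to its first term. -/
theorem exists_sum_sq_symbol_le (hχ : IsCutoff χ) (m c : ℕ) {s : ℝ} (hs : 0 < s) :
    ∃ C, 0 ≤ C ∧ ∀ (S : Finset ℕ) (ξ : E),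
      ∑ j ∈ S, (((2 : ℝ) ^ (j + (m + 2))) ^ (-s) * ‖symbol χ ((j + (m + 2) + c : ℕ) : ℤ) ξ‖) ^ 2 ≤
        C ^ 2 * (1 + ‖ξ‖ ^ 2) ^ (-s) := by
  set A : ℝ := 1 + (2 * 2 ^ c) ^ 2 with hA
  have hA1 : 1 ≤ A := by rw [hA]; linarith [sq_nonneg ((2 : ℝ) * 2 ^ c)]
  -- The squares of the dyadic weights are the powers of `r`.
  set r : ℝ := 2 ^ (-(2 * s)) with hr
  have hr0 : 0 < r := by positivity
  have hr1 : r < 1 := Real.rpow_lt_one_of_one_lt_of_neg one_lt_two (by linarith)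
  have h1r : 0 < 1 - r := by linarith
  refine ⟨√(A ^ s / (1 - r)), Real.sqrt_nonneg _, fun S ξ ↦ ?_⟩
  rw [Real.sq_sqrt (by positivity)]
  set Y : ℝ := 1 + ‖ξ‖ ^ 2 with hY
  have hY0 : 0 < Y := by positivity
  have hrk : ∀ k : ℕ, (((2 : ℝ) ^ k) ^ (-s)) ^ 2 = r ^ k := fun k ↦ by
    rw [hr, ← Real.rpow_natCast, ← Real.rpow_natCast, ← Real.rpow_natCast,
      ← Real.rpow_mul (by positivity), ← Real.rpow_mul (by positivity),
      ← Real.rpow_mul (by positivity)]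
    congr 1
    push_cast
    ring
  have hsupp : ∀ k : ℕ, symbol χ ((k + c : ℕ) : ℤ) ξ ≠ 0 → r ^ k ≤ A ^ s * Y ^ (-s) := by
    intro k h
    have h1 := lt_of_symbol_ne_zero hχ h
    rw [zpow_natCast, pow_add] at h1
    have hx1 : (1 : ℝ) ≤ 2 ^ k := one_le_pow₀ one_le_two
    have h2 : ‖ξ‖ ≤ 2 ^ k * (2 * 2 ^ c) := by
      have hc : (0 : ℝ) < 2 ^ k * 2 ^ c := by positivity
      nlinarith [norm_nonneg ξ, Real.pi_gt_three]
    have h3 : Y ≤ A * (2 ^ k) ^ 2 := by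
      have : ‖ξ‖ ^ 2 ≤ (2 ^ k * (2 * 2 ^ c)) ^ 2 := by gcongr
      rw [hA, hY]
      nlinarith
    have h4 : Y / A ≤ (2 ^ k) ^ 2 := by rw [div_le_iff₀ (by positivity)]; linarith
    have h5 : (((2 : ℝ) ^ k) ^ 2) ^ (-s) ≤ (Y / A) ^ (-s) :=
      Real.rpow_le_rpow_of_nonpos (by positivity) h4 (by linarith)
    have h6 : (Y / A) ^ (-s) = A ^ s * Y ^ (-s) := by
      rw [Real.div_rpow hY0.le (by positivity), Real.rpow_neg (by positivity : 0 ≤ A),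
        div_inv_eq_mul, mul_comm]
    rw [← hrk, ← h6]
    refine le_trans (le_of_eq ?_) h5
    rw [← Real.rpow_natCast, ← Real.rpow_natCast (((2 : ℝ) ^ k)), ← Real.rpow_mul (by positivity),
      ← Real.rpow_mul (by positivity), mul_comm]
  set T : Finset ℕ := S.filter fun j ↦ symbol χ ((j + (m + 2) + c : ℕ) : ℤ) ξ ≠ 0 with hT
  have hle : ∑ j ∈ S, (((2 : ℝ) ^ (j + (m + 2))) ^ (-s) *
      ‖symbol χ ((j + (m + 2) + c : ℕ) : ℤ) ξ‖) ^ 2 ≤ ∑ j ∈ T, r ^ (j + (m + 2)) := by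
    rw [hT, Finset.sum_filter]
    refine Finset.sum_le_sum fun j _ ↦ ?_
    split_ifs with h
    · rw [mul_pow, hrk]
      refine mul_le_of_le_one_right (by positivity) ?_
      exact pow_le_one₀ (norm_nonneg _) (norm_symbol_le_one hχ _ _)
    · rw [not_not] at h
      rw [h]
      simp
  refine hle.trans ?_
  have hsum := sum_pow_le_of_pow_le hr0 hr1 (c := A ^ s * Y ^ (-s) / r ^ (m + 2)) (by positivity) T
    fun j hj ↦ by
      rw [le_div_iff₀ (by positivity), ← pow_add]
      exact hsupp _ (Finset.mem_filter.mp hj).2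
  calc ∑ j ∈ T, r ^ (j + (m + 2)) = (∑ j ∈ T, r ^ j) * r ^ (m + 2) := by
        rw [Finset.sum_mul]; simp_rw [pow_add]
    _ ≤ A ^ s * Y ^ (-s) / r ^ (m + 2) / (1 - r) * r ^ (m + 2) := by gcongr
    _ = _ := by field_simp

end Overlap

/-! ### Localization of products -/

section Localization

variable {E : Type*} [NormedAddCommGroup E] [InnerProductSpace ℝ E] [FiniteDimensional ℝ E]
  [MeasurableSpace E] [BorelSpace E]

theorem fourierInv_schwartz_sub (f g : 𝓢(E, ℂ)) : (𝓕⁻ (f - g) : 𝓢(E, ℂ)) = 𝓕⁻ f - 𝓕⁻ g :=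
  (fourierInvCLM ℂ 𝓢(E, ℂ)).map_sub f g

theorem Localizes.sub {p q b b' : E → ℂ} (hb : b.HasTemperateGrowth) (hb' : b'.HasTemperateGrowth)
    (h : Localizes p q b) (h' : Localizes p q b') : Localizes p q (b - b') := fun φ ξ ↦ by
  rw [SchwartzMap.smulLeftCLM_sub hb hb', sub_apply, sub_apply, fourierInv_schwartz_sub,
    fourierInv_schwartz_sub, sub_apply, sub_apply, mul_sub, mul_sub, h φ ξ, h' φ ξ]

theorem localizes_lowFreqFun {E : Type} [NormedAddCommGroup E] [InnerProductSpace ℝ E]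
    [FiniteDimensional ℝ E] [MeasurableSpace E] [BorelSpace E] {χ : ℝ → ℝ} {a : E → ℂ}
    (hχ : IsCutoff χ) (k : ℤ) (ha : MemLp a ⊤ volume) {p q : E → ℂ} (hq : q.HasTemperateGrowth)
    (h : ∀ ξ ζ, p ξ ≠ 0 → symbol χ k ζ ≠ 0 → q (ξ + ζ) = 1) :
    Localizes p q (lowFreqFun χ k a) := by
  intro φ ξ
  by_cases hp : p ξ = 0
  · simp [hp]
  set ψ : 𝓢(E, ℂ) := 𝓕 (SchwartzMap.smulLeftCLM ℂ q (𝓕⁻ φ)) with hψ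
  -- `φ - ψ` has no frequencies in the region that can contribute at `ξ`.
  have h0 := fourierInv_lowFreqFun_smul_eq_zero hχ k ha (φ - ψ) ξ fun ζ hζ ↦ by
    rw [fourierInv_schwartz_sub, hψ, fourierInv_fourier_eq, sub_apply,
      SchwartzMap.smulLeftCLM_apply_apply hq, h ξ ζ hp hζ, one_smul, sub_self]
  rw [map_sub, fourierInv_schwartz_sub, sub_apply, sub_eq_zero] at h0
  rw [h0]

end Localization

/-! ### Bounds for the paraproduct and the remainder -/

section Bounds

variable {E : Type*} [NormedAddCommGroup E] [InnerProductSpace ℝ E] [FiniteDimensional ℝ E]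
  [MeasurableSpace E] [BorelSpace E] {χ : ℝ → ℝ}

theorem sobolevNorm_add_le {t : ℝ} {u v : 𝓢'(E, ℂ)} (hu : MemSobolev t 2 u)
    (hv : MemSobolev t 2 v) : sobolevNorm t (u + v) ≤ sobolevNorm t u + sobolevNorm t v := by
  obtain ⟨f, hf⟩ := hu
  obtain ⟨g, hg⟩ := hv
  have h : besselPotential E ℂ t (u + v) = ((f + g : Lp ℂ 2 (volume : Measure E)) : 𝓢'(E, ℂ)) := by
    rw [map_add, hf, hg]
    exact ((Lp.toTemperedDistributionCLM ℂ (volume : Measure E) 2).map_add f g).symm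
  rw [sobolevNorm_eq hf, sobolevNorm_eq hg, sobolevNorm_eq h]
  exact norm_add_le f g

theorem lowFreq_of_nonneg (χ : ℝ → ℝ) {k : ℤ} (hk : 0 ≤ k) (u : 𝓢'(E, ℂ)) :
    lowFreq χ k u = fourierMultiplierCLM ℂ (symbol χ k) u := by
  rw [lowFreq, if_neg hk.not_gt]

theorem block_eq (hχ : IsCutoff χ) {k : ℕ} (hk : 1 ≤ k) (u : 𝓢'(E, ℂ)) :
    block χ k u = fourierMultiplierCLM ℂ (blockSymbol χ k) u := by
  rw [block, lowFreq_of_nonneg χ (by omega), lowFreq_of_nonneg χ (by omega),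
    fourierMultiplierCLM_apply, fourierMultiplierCLM_apply, fourierMultiplierCLM_apply]
  have : (blockSymbol χ k : E → ℂ) = symbol χ k - symbol χ ((k : ℤ) - 1) := rfl
  rw [this, smulLeftCLM_sub (hasTemperateGrowth_symbol hχ _) (hasTemperateGrowth_symbol hχ _)]
  exact ((fourierInvCLM ℂ 𝓢'(E, ℂ)).map_sub _ _).symm

theorem exists_sq_symbol_le (hχ : IsCutoff χ) (k : ℤ) (t : ℝ) :
    ∃ C, 0 ≤ C ∧ ∀ ξ : E, ‖symbol χ k ξ‖ ^ 2 ≤ C ^ 2 * (1 + ‖ξ‖ ^ 2) ^ t := by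
  set A : ℝ := 1 + (19 / 10 * 2 ^ k) ^ 2 with hA
  refine ⟨√(A ^ |t|), Real.sqrt_nonneg _, fun ξ ↦ ?_⟩
  rw [Real.sq_sqrt (by positivity)]
  by_cases h : symbol χ k ξ = 0
  · rw [h]; simp; positivity
  have h1 := lt_of_symbol_ne_zero hχ h
  have h2 : ‖ξ‖ ≤ 19 / 10 * 2 ^ k := by nlinarith [norm_nonneg ξ, Real.pi_gt_three]
  have h3 : ‖ξ‖ ^ 2 ≤ (19 / 10 * 2 ^ k) ^ 2 := by gcongr
  have hA1 : 1 ≤ A := by rw [hA]; linarith [sq_nonneg ((19 : ℝ) / 10 * 2 ^ k)]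
  have h4 := rpow_le_of_comparable one_pos (by positivity : 0 < 1 + ‖ξ‖ ^ 2) hA1
    (by nlinarith [sq_nonneg ‖ξ‖]) (by rw [mul_one, hA]; linarith) t
  rw [Real.one_rpow] at h4
  exact (pow_le_one₀ (norm_nonneg _) (norm_symbol_le_one hχ _ _)).trans h4

end Bounds

section Operators

variable {E : Type} [NormedAddCommGroup E] [InnerProductSpace ℝ E] [FiniteDimensional ℝ E]
  [MeasurableSpace E] [BorelSpace E] {χ : ℝ → ℝ} {a : E → ℂ}

theorem localizes_para (hχ : IsCutoff χ) (k : ℤ) (ha : MemLp a ⊤ volume) :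
    Localizes (blockSymbol χ k) (fatSymbol χ k) (lowFreqFun χ (k - 3) a) := by
  refine localizes_lowFreqFun hχ _ ha (hasTemperateGrowth_fatSymbol hχ k) fun ξ ζ hξ hζ ↦ ?_
  obtain ⟨h1, h2⟩ := lt_of_blockSymbol_ne_zero hχ hξ
  have h3 := lt_of_symbol_ne_zero hχ hζ
  have e' : (2 : ℝ) ^ (k - 3) = 2 ^ k / 8 := by
    rw [zpow_sub₀ two_ne_zero]; norm_num
  have hk : (0 : ℝ) < 2 ^ k := by positivity
  rw [e'] at h3
  have h4 : 2 * Real.pi * ‖ξ + ζ‖ ≤ 2 * Real.pi * (‖ξ‖ + ‖ζ‖) := by gcongr; exact norm_add_le _ _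
  have h5 : 2 * Real.pi * (‖ξ‖ - ‖ζ‖) ≤ 2 * Real.pi * ‖ξ + ζ‖ := by
    gcongr
    have := norm_sub_le (ξ + ζ) ζ
    rw [add_sub_cancel_right] at this
    linarith
  exact fatSymbol_eq_one hχ (by linarith) (by linarith)

theorem localizes_low (hχ : IsCutoff χ) {k l : ℤ} (hl : l ≤ k - 2) (ha : MemLp a ⊤ volume) :
    Localizes (symbol χ k) (symbol χ (k + 2)) (lowFreqFun χ l a) := by
  refine localizes_lowFreqFun hχ _ ha (hasTemperateGrowth_symbol hχ _) fun ξ ζ hξ hζ ↦ ?_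
  have h1 := lt_of_symbol_ne_zero hχ hξ
  have h2 := lt_of_symbol_ne_zero hχ hζ
  have e : (2 : ℝ) ^ (k + 2) = 4 * 2 ^ k := by rw [zpow_add₀ two_ne_zero]; norm_num; ring
  have h3 : (2 : ℝ) ^ l ≤ 2 ^ (k - 2) := zpow_le_zpow_right₀ one_le_two hl
  have e' : (2 : ℝ) ^ (k - 2) = 2 ^ k / 4 := by rw [zpow_sub₀ two_ne_zero]; norm_num
  have hk : (0 : ℝ) < 2 ^ k := by positivity
  exact symbol_add_eq_one hχ h1.le h2.le (by rw [e]; linarith)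

/-- Boundedness of the paraproduct on every Sobolev space: the terms have frequencies in dyadic
annuli, so the overlap conditions hold for all real exponents. -/
theorem exists_modifiedParaproduct_bound (hχ : IsCutoff χ) (m : ℕ) (t : ℝ) :
    ∃ C, 0 ≤ C ∧ ∀ a : E → ℂ, MemLp a ⊤ volume → ∀ u : 𝓢'(E, ℂ), MemSobolev t 2 u →
      (Summable fun j : ℕ ↦ paraTerm χ a u (j + (m + 2))) ∧
      MemSobolev t 2 (modifiedParaproduct χ m a u) ∧
      sobolevNorm t (modifiedParaproduct χ m a u) ≤ C * supNorm a * sobolevNorm t u := by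
  obtain ⟨C₁, hC₁, h₁⟩ := exists_sum_sq_fatSymbol_le (E := E) hχ m t
  obtain ⟨C₂, hC₂, h₂⟩ := exists_sum_sq_fatSymbol_le (E := E) hχ m (-t)
  obtain ⟨C₃, hC₃, h₃⟩ := exists_sq_symbol_le (E := E) hχ ((m : ℤ) + 1) t
  obtain ⟨C₄, hC₄, h₄⟩ := exists_sq_symbol_le (E := E) hχ ((m : ℤ) + 1 + 2) (-t)
  set M : ℝ := ∫ y : E, ‖kernel χ 0 y‖ with hM
  have hM0 : 0 ≤ M := integral_nonneg fun _ ↦ norm_nonneg _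
  refine ⟨C₃ * C₄ * M + C₁ * C₂ * M, by positivity, fun a ha u hu ↦ ?_⟩
  have hB : 0 ≤ supNorm a * M := mul_nonneg (supNorm_nonneg a) hM0
  have hpow : ∀ j : ℕ, ((2 : ℝ) ^ (j + (m + 2))) ^ t * ((2 : ℝ) ^ (j + (m + 2))) ^ (-t) = 1 :=
    fun j ↦ by rw [← Real.rpow_add (by positivity)]; simp
  have hseries := summable_smul_multiplier (ι := ℕ) (t := t) (t' := t)
    (p := fun j ↦ blockSymbol χ ((j + (m + 2) : ℕ) : ℤ))
    (q := fun j ↦ fatSymbol χ ((j + (m + 2) : ℕ) : ℤ))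
    (b := fun j ↦ lowFreqFun χ (((j + (m + 2) : ℕ) : ℤ) - 3) a)
    (β := fun j ↦ ((2 : ℝ) ^ (j + (m + 2))) ^ t) (γ := fun j ↦ ((2 : ℝ) ^ (j + (m + 2))) ^ (-t))
    hB hC₁ hC₂ (fun j ↦ by positivity) (fun j ↦ by positivity)
    (fun j ↦ hasTemperateGrowth_blockSymbol hχ _) (fun j ↦ hasTemperateGrowth_fatSymbol hχ _)
    (fun j ↦ hasTemperateGrowth_lowFreqFun hχ _ ha)
    (fun j x ↦ by rw [hpow, mul_one]; exact norm_lowFreqFun_le hχ _ ha x)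
    (fun j ↦ localizes_para hχ _ ha)
    (fun S ξ ↦ (Finset.sum_le_sum fun j _ ↦ by
      gcongr; exact norm_blockSymbol_le hχ _ ξ).trans (h₁ S ξ))
    h₂ hu
  have hterm : ∀ j : ℕ, paraTerm χ a u (j + (m + 2)) =
      smulLeftCLM ℂ (lowFreqFun χ (((j + (m + 2) : ℕ) : ℤ) - 3) a)
        (fourierMultiplierCLM ℂ (blockSymbol χ ((j + (m + 2) : ℕ) : ℤ)) u) := fun j ↦ by
    rw [paraTerm, block_eq hχ (by omega)]
  simp_rw [← hterm] at hseries
  have hunit : ∀ (S : Finset Unit) (x y : ℝ), x ^ 2 ≤ y → ∑ i ∈ S, (1 * x) ^ 2 ≤ y :=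
    fun S x y hxy ↦ by
      refine (Finset.sum_le_sum_of_subset_of_nonneg (Finset.subset_univ S)
        fun _ _ _ ↦ by positivity).trans ?_
      simpa using hxy
  -- The first term of the paraproduct is treated as a series with a single term.
  have hfirst := summable_smul_multiplier (ι := Unit) (t := t) (t' := t)
    (p := fun _ ↦ symbol χ ((m : ℤ) + 1)) (q := fun _ ↦ symbol χ ((m : ℤ) + 1 + 2))
    (b := fun _ ↦ lowFreqFun χ ((m : ℤ) - 1) a) (β := fun _ ↦ 1) (γ := fun _ ↦ 1)
    hB hC₃ hC₄ (fun _ ↦ zero_le_one) (fun _ ↦ zero_le_one)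
    (fun _ ↦ hasTemperateGrowth_symbol hχ _) (fun _ ↦ hasTemperateGrowth_symbol hχ _)
    (fun _ ↦ hasTemperateGrowth_lowFreqFun hχ _ ha)
    (fun _ x ↦ by rw [mul_one, mul_one]; exact norm_lowFreqFun_le hχ _ ha x)
    (fun _ ↦ localizes_low hχ (by omega) ha)
    (fun S ξ ↦ hunit S _ _ (h₃ ξ)) (fun S ξ ↦ hunit S _ _ (h₄ ξ)) hu
  rw [tsum_fintype, Finset.univ_unique, Finset.sum_singleton,
    ← lowFreq_of_nonneg χ (by omega)] at hfirst
  refine ⟨hseries.1, hfirst.2.1.add hseries.2.1, ?_⟩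
  refine (sobolevNorm_add_le hfirst.2.1 hseries.2.1).trans ?_
  refine (add_le_add hfirst.2.2 hseries.2.2).trans (le_of_eq ?_)
  ring

/-- The terms `Δ_{j+m} a S_{j+m+2} u` of the series that represents `a u - T^m_a u`. -/
noncomputable def remainderTerm (χ : ℝ → ℝ) (m : ℕ) (a : E → ℂ) (u : 𝓢'(E, ℂ)) (j : ℕ) :
    𝓢'(E, ℂ) :=
  smulLeftCLM ℂ (lowFreqFun χ ((j : ℤ) + m) a - lowFreqFun χ ((j : ℤ) + m - 1) a)
    (lowFreq χ ((j : ℤ) + m + 2) u)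

theorem MemLip.memLp (ha : MemLip a) : MemLp a ⊤ volume := by
  obtain ⟨⟨M, hM⟩, K, hK⟩ := ha
  exact memLp_top_of_bound hK.continuous.aestronglyMeasurable M (.of_forall hM)

theorem MemLip.norm_sub_le (ha : MemLip a) (x y : E) :
    ‖a x - a y‖ ≤ supNorm (fderiv ℝ a) * ‖x - y‖ := by
  obtain ⟨-, K, hK⟩ := ha
  refine norm_sub_le_of_ae_norm_fderiv_le hK (norm_le_supNorm_ae ?_) x y
  exact memLp_top_of_bound (measurable_fderiv ℝ a).aestronglyMeasurable K
    (.of_forall fun x ↦ norm_fderiv_le_of_lipschitz ℝ hK)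

/-- The Littlewood-Paley blocks of a Lipschitz function decay like `2 ^ (-l)`. For `l = 0` the
subtracted term is zero by definition, and the bound of `a` is used in place of its gradient. -/
theorem exists_norm_lowFreqFun_sub_le (hχ : IsCutoff χ) :
    ∃ C, 0 ≤ C ∧ ∀ a : E → ℂ, MemLip a → ∀ (l : ℕ) x,
      ‖lowFreqFun χ (l : ℤ) a x - lowFreqFun χ ((l : ℤ) - 1) a x‖ ≤
        C * lipNorm a * ((2 : ℝ) ^ (l + 2))⁻¹ := by
  set M₀ : ℝ := ∫ y : E, ‖kernel χ 0 y‖ with hM₀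
  set M₁ : ℝ := ∫ y : E, ‖kernel χ 0 y‖ * ‖y‖ with hM₁
  have h0 : 0 ≤ M₀ := integral_nonneg fun _ ↦ norm_nonneg _
  have h1 : 0 ≤ M₁ := integral_nonneg fun _ ↦ by positivity
  refine ⟨12 * (M₀ + M₁), by positivity, fun a ha l x ↦ ?_⟩
  have hA := supNorm_nonneg a
  have hL := supNorm_nonneg (fderiv ℝ a)
  rw [lipNorm]
  set A := supNorm a
  set L := supNorm (fderiv ℝ a)
  rcases Nat.eq_zero_or_pos l with rfl | hl
  · rw [lowFreqFun_of_neg χ (k := ((0 : ℕ) : ℤ) - 1) (by norm_num), Pi.zero_apply, sub_zero]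
    refine (norm_lowFreqFun_le hχ _ ha.memLp x).trans ?_
    change A * M₀ ≤ _
    norm_num
    nlinarith [mul_nonneg hA h0, mul_nonneg hA h1, mul_nonneg hL h0, mul_nonneg hL h1]
  · have e1 := norm_lowFreqFun_sub_le hχ (k := (l : ℤ)) (by omega) ha.memLp ha.norm_sub_le x
    have e2 := norm_lowFreqFun_sub_le hχ (k := (l : ℤ) - 1) (by omega) ha.memLp ha.norm_sub_le x
    have p1 : (2 : ℝ) ^ (-(l : ℤ)) = 4 * ((2 : ℝ) ^ (l + 2))⁻¹ := by
      rw [zpow_neg, zpow_natCast, pow_add]; field_simp; norm_num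
    have p2 : (2 : ℝ) ^ (-((l : ℤ) - 1)) = 8 * ((2 : ℝ) ^ (l + 2))⁻¹ := by
      rw [show -((l : ℤ) - 1) = -(l : ℤ) + 1 by ring, zpow_add_one₀ two_ne_zero, p1]; ring
    rw [p1] at e1
    rw [p2] at e2
    set P : ℝ := ((2 : ℝ) ^ (l + 2))⁻¹ with hP
    have hP0 : 0 ≤ P := by positivity
    calc _ = ‖(lowFreqFun χ (l : ℤ) a x - a x) - (lowFreqFun χ ((l : ℤ) - 1) a x - a x)‖ := by
          congr 1; ring
      _ ≤ L * (4 * P * M₁) + L * (8 * P * M₁) := (norm_sub_le _ _).trans (add_le_add e1 e2)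
      _ = 12 * (L * M₁) * P := by ring
      _ ≤ 12 * ((M₀ + M₁) * (A + L)) * P := by
        have : L * M₁ ≤ (M₀ + M₁) * (A + L) := by
          nlinarith [mul_nonneg hA h0, mul_nonneg hA h1, mul_nonneg hL h0]
        exact mul_le_mul_of_nonneg_right (by linarith) hP0
      _ = _ := by ring

/-- The remainder `∑ Δ_{j+m} a S_{j+m+2} u` gains one derivative. The terms have frequencies in
dyadic balls only, so both exponents of the weights, `-s` and `-(1 - s)`, have to be negative. -/
theorem exists_remainder_bound (hχ : IsCutoff χ) (m : ℕ) {s : ℝ} (hs : s ∈ Set.Ioo (0 : ℝ) 1) :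
    ∃ C, 0 ≤ C ∧ ∀ a : E → ℂ, MemLip a → ∀ u : 𝓢'(E, ℂ), MemSobolev (-s) 2 u →
      Summable (remainderTerm χ m a u) ∧
      MemSobolev (1 - s) 2 (∑' j, remainderTerm χ m a u j) ∧
      sobolevNorm (1 - s) (∑' j, remainderTerm χ m a u j) ≤ C * lipNorm a * sobolevNorm (-s) u := by
  obtain ⟨C₁, hC₁, h₁⟩ := exists_sum_sq_symbol_le (E := E) hχ m 0 hs.1
  obtain ⟨C₂, hC₂, h₂⟩ := exists_sum_sq_symbol_le (E := E) hχ m 2 (sub_pos.mpr hs.2)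
  obtain ⟨C₃, hC₃, h₃⟩ := exists_norm_lowFreqFun_sub_le (E := E) hχ
  refine ⟨C₁ * C₂ * C₃, by positivity, fun a ha u hu ↦ ?_⟩
  have hlip : 0 ≤ lipNorm a := add_nonneg (supNorm_nonneg _) (supNorm_nonneg _)
  have hg : ∀ k, (lowFreqFun χ k a).HasTemperateGrowth := fun k ↦
    hasTemperateGrowth_lowFreqFun hχ k ha.memLp
  have hpow : ∀ j : ℕ, ((2 : ℝ) ^ (j + (m + 2))) ^ (-s) * ((2 : ℝ) ^ (j + (m + 2))) ^ (-(1 - s)) =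
      ((2 : ℝ) ^ (j + m + 2))⁻¹ := fun j ↦ by
    rw [← Real.rpow_add (by positivity), show -s + -(1 - s) = -1 by ring, Real.rpow_neg_one,
      add_assoc]
  have hseries := summable_smul_multiplier (ι := ℕ) (t := -s) (t' := 1 - s)
    (p := fun j ↦ symbol χ ((j + (m + 2) + 0 : ℕ) : ℤ))
    (q := fun j ↦ symbol χ ((j + (m + 2) + 2 : ℕ) : ℤ))
    (b := fun j ↦ lowFreqFun χ ((j : ℤ) + m) a - lowFreqFun χ ((j : ℤ) + m - 1) a)
    (β := fun j ↦ ((2 : ℝ) ^ (j + (m + 2))) ^ (-s))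
    (γ := fun j ↦ ((2 : ℝ) ^ (j + (m + 2))) ^ (-(1 - s)))
    (mul_nonneg hC₃ hlip) hC₁ hC₂ (fun j ↦ by positivity) (fun j ↦ by positivity)
    (fun j ↦ hasTemperateGrowth_symbol hχ _) (fun j ↦ hasTemperateGrowth_symbol hχ _)
    (fun j ↦ (hg _).sub (hg _))
    (fun j x ↦ by
      rw [hpow]
      have := h₃ a ha (j + m) x
      push_cast at this
      exact this)
    (fun j ↦ by
      have e : ((j + (m + 2) + 2 : ℕ) : ℤ) = ((j + (m + 2) + 0 : ℕ) : ℤ) + 2 := by push_cast; ring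
      rw [e]
      exact (localizes_low hχ (by push_cast; omega) ha.memLp).sub (hg _) (hg _)
        (localizes_low hχ (by push_cast; omega) ha.memLp))
    h₁ h₂ hu
  have hterm : ∀ j : ℕ, smulLeftCLM ℂ (lowFreqFun χ ((j : ℤ) + m) a -
      lowFreqFun χ ((j : ℤ) + m - 1) a)
        (fourierMultiplierCLM ℂ (symbol χ ((j + (m + 2) + 0 : ℕ) : ℤ)) u) =
      remainderTerm χ m a u j := fun j ↦ by
    rw [remainderTerm, lowFreq_of_nonneg χ (by omega)]
    push_cast
    ring_nf
  simp_rw [hterm] at hseries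
  refine ⟨hseries.1, hseries.2.1, hseries.2.2.trans (le_of_eq ?_)⟩
  ring

end Operators

/-! ### The product with a Lipschitz function -/

section Product

open Filter Topology

variable {E : Type} [NormedAddCommGroup E] [InnerProductSpace ℝ E] [FiniteDimensional ℝ E]
  [MeasurableSpace E] [BorelSpace E] {χ : ℝ → ℝ} {a : E → ℂ}

/-- The operators `u ↦ S_{N+m-1} a S_{N+m+1} u`, which approximate the product with `a`. -/
noncomputable def approxProduct (χ : ℝ → ℝ) (m : ℕ) (a : E → ℂ) (N : ℕ) :
    𝓢'(E, ℂ) →L[ℂ] 𝓢'(E, ℂ) :=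
  smulLeftCLM ℂ (lowFreqFun χ ((N : ℤ) + m - 1) a) ∘L
    fourierMultiplierCLM ℂ (symbol χ ((N : ℤ) + m + 1))

theorem approxProduct_apply (χ : ℝ → ℝ) (m : ℕ) (a : E → ℂ) (N : ℕ) (u : 𝓢'(E, ℂ)) :
    approxProduct χ m a N u =
      smulLeftCLM ℂ (lowFreqFun χ ((N : ℤ) + m - 1) a) (lowFreq χ ((N : ℤ) + m + 1) u) := by
  rw [lowFreq_of_nonneg χ (by omega)]
  rfl

/-- Summation by parts: the terms of the paraproduct and of the remainder together telescope. -/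
theorem paraTerm_add_remainderTerm (hχ : IsCutoff χ) (m : ℕ) (ha : MemLp a ⊤ volume)
    (u : 𝓢'(E, ℂ)) (j : ℕ) : paraTerm χ a u (j + (m + 2)) + remainderTerm χ m a u j =
      approxProduct χ m a (j + 1) u - approxProduct χ m a j u := by
  have hg : ∀ k, (lowFreqFun χ k a).HasTemperateGrowth := fun k ↦
    hasTemperateGrowth_lowFreqFun hχ k ha
  rw [approxProduct_apply, approxProduct_apply, paraTerm, remainderTerm, block,
    smulLeftCLM_sub (hg _) (hg _), map_sub, sub_apply]
  have e1 : ((j + (m + 2) : ℕ) : ℤ) - 3 = (j : ℤ) + m - 1 := by push_cast; ring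
  have e2 : ((j + (m + 2) : ℕ) : ℤ) = (j : ℤ) + m + 2 := by push_cast; ring
  have e3 : ((j + 1 : ℕ) : ℤ) + m - 1 = (j : ℤ) + m := by push_cast; ring
  have e4 : ((j + 1 : ℕ) : ℤ) + m + 1 = (j : ℤ) + m + 2 := by push_cast; ring
  have e5 : (j : ℤ) + m + 2 - 1 = (j : ℤ) + m + 1 := by ring
  rw [e1, e2, e3, e4, e5]
  abel

theorem tendsto_approxProduct (hχ : IsCutoff χ) (m : ℕ) (ha : MemLp a ⊤ volume) {u : 𝓢'(E, ℂ)}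
    (h₁ : Summable fun j : ℕ ↦ paraTerm χ a u (j + (m + 2)))
    (h₂ : Summable (remainderTerm χ m a u)) :
    Tendsto (fun N ↦ approxProduct χ m a N u) atTop
      (𝓝 (modifiedParaproduct χ m a u + ∑' j, remainderTerm χ m a u j)) := by
  have h := ((h₁.hasSum.add h₂.hasSum).tendsto_sum_nat).const_add (approxProduct χ m a 0 u)
  have e : ∀ N : ℕ, approxProduct χ m a 0 u +
      ∑ j ∈ Finset.range N, (paraTerm χ a u (j + (m + 2)) + remainderTerm χ m a u j) =
        approxProduct χ m a N u := fun N ↦ by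
    simp_rw [paraTerm_add_remainderTerm hχ m ha]
    rw [Finset.sum_range_sub (fun j ↦ approxProduct χ m a j u), add_sub_cancel]
  simp_rw [e] at h
  convert h using 2
  rw [modifiedParaproduct, approxProduct_apply, add_assoc]
  simp

/-- Multipliers with even symbols can be written with the two Fourier transforms in either order. -/
theorem fourier_smul_fourierInv_of_even {q : E → ℂ} (hq : q.HasTemperateGrowth)
    (he : ∀ ξ, q (-ξ) = q ξ) (θ : 𝓢(E, ℂ)) :
    𝓕 (SchwartzMap.smulLeftCLM ℂ q (𝓕⁻ θ)) = 𝓕⁻ (SchwartzMap.smulLeftCLM ℂ q (𝓕 θ)) := by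
  have h : (SchwartzMap.smulLeftCLM ℂ q (𝓕⁻ θ) : E → ℂ) =
      fun ξ ↦ SchwartzMap.smulLeftCLM ℂ q (𝓕 θ) (-ξ) := by
    ext ξ
    rw [SchwartzMap.smulLeftCLM_apply_apply hq, SchwartzMap.smulLeftCLM_apply_apply hq, he,
      SchwartzMap.fourier_coe, SchwartzMap.fourierInv_coe, Real.fourierInv_eq_fourier_neg]
  ext x
  rw [SchwartzMap.fourier_coe, SchwartzMap.fourierInv_coe, Real.fourierInv_eq_fourier_comp_neg, h]

theorem bracket_even (r : ℝ) (ξ : E) : bracket r (-ξ) = bracket r ξ := by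
  simp [bracket]

theorem tendsto_symbol (hχ : IsCutoff χ) (l : ℤ) (ξ : E) :
    Tendsto (fun N : ℕ ↦ symbol χ ((N : ℤ) + l) ξ) atTop (𝓝 1) := by
  refine tendsto_const_nhds.congr' ?_
  have h : Tendsto (fun N : ℕ ↦ (11 / 10 * 2 ^ l) * (2 : ℝ) ^ N) atTop atTop :=
    (tendsto_pow_atTop_atTop_of_one_lt one_lt_two).const_mul_atTop (by positivity)
  filter_upwards [h.eventually_ge_atTop (2 * Real.pi * ‖ξ‖)] with N hN
  refine (symbol_eq_one hχ (hN.trans (le_of_eq ?_))).symm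
  rw [zpow_add₀ two_ne_zero, zpow_natCast]
  ring

theorem tendsto_lowFreqFun (hχ : IsCutoff χ) (ha : MemLip a) (l : ℤ) (x : E) :
    Tendsto (fun N : ℕ ↦ lowFreqFun χ ((N : ℤ) + l) a x) atTop (𝓝 (a x)) := by
  rw [tendsto_iff_norm_sub_tendsto_zero]
  set D : ℝ := supNorm (fderiv ℝ a) * (2 ^ (-l) * ∫ y : E, ‖kernel χ 0 y‖ * ‖y‖) with hD
  have h : Tendsto (fun N : ℕ ↦ D * (1 / 2 : ℝ) ^ N) atTop (𝓝 0) := by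
    simpa using (tendsto_pow_atTop_nhds_zero_of_lt_one (r := (1 / 2 : ℝ)) (by norm_num)
      (by norm_num)).const_mul D
  refine tendsto_of_tendsto_of_tendsto_of_le_of_le' tendsto_const_nhds h
    (.of_forall fun _ ↦ norm_nonneg _) ?_
  filter_upwards [eventually_ge_atTop (-l).toNat] with N hN
  refine (norm_lowFreqFun_sub_le hχ (by omega) ha.memLp ha.norm_sub_le x).trans (le_of_eq ?_)
  rw [hD, neg_add, zpow_add₀ two_ne_zero, zpow_neg, zpow_natCast, one_div, inv_pow]
  ring

/-- For Schwartz functions `ψ` the operators `S_{N+m-1} a S_{N+m+1}` converge to the product with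
the Lipschitz function `a`. -/
theorem tendsto_approxProduct_schwartz (hχ : IsCutoff χ) (m : ℕ) (ha : MemLip a) (ψ φ : 𝓢(E, ℂ)) :
    Tendsto (fun N ↦ approxProduct χ m a N (ψ : 𝓢'(E, ℂ)) φ) atTop
      (𝓝 (∫ x, a x * φ x * ψ x)) := by
  set ψN : ℕ → 𝓢(E, ℂ) := fun N ↦
    𝓕⁻ (SchwartzMap.smulLeftCLM ℂ (symbol χ ((N : ℤ) + m + 1)) (𝓕 ψ)) with hψN
  have hψx : ∀ N x, ψN N x = ∫ v : E, (Real.fourierChar (inner ℝ v x) : ℂ) *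
      (symbol χ ((N : ℤ) + m + 1) v * (𝓕 ψ : 𝓢(E, ℂ)) v) := fun N x ↦ by
    rw [hψN, SchwartzMap.fourierInv_coe, Real.fourierInv_eq]
    refine integral_congr_ae (.of_forall fun v ↦ ?_)
    simp only [Circle.smul_def, smul_eq_mul]
    rw [SchwartzMap.smulLeftCLM_apply_apply (hasTemperateGrowth_symbol hχ _), smul_eq_mul]
  have hbd : ∀ N x v, ‖(Real.fourierChar (inner ℝ v x) : ℂ) *
      (symbol χ ((N : ℤ) + m + 1) v * (𝓕 ψ : 𝓢(E, ℂ)) v)‖ ≤ ‖(𝓕 ψ : 𝓢(E, ℂ)) v‖ := fun N x v ↦ by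
    rw [norm_mul, Circle.norm_coe, one_mul, norm_mul]
    exact mul_le_of_le_one_left (norm_nonneg _) (norm_symbol_le_one hχ _ _)
  have hψlim : ∀ x, Tendsto (fun N ↦ ψN N x) atTop (𝓝 (ψ x)) := fun x ↦ by
    have e : ψ x = ∫ v : E, (Real.fourierChar (inner ℝ v x) : ℂ) * (1 * (𝓕 ψ : 𝓢(E, ℂ)) v) := by
      have : ψ = 𝓕⁻ (𝓕 ψ : 𝓢(E, ℂ)) := (fourierInv_fourier_eq ψ).symm
      conv_lhs => rw [this]
      rw [SchwartzMap.fourierInv_coe, Real.fourierInv_eq]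
      simp [Circle.smul_def]
    rw [e]
    simp_rw [hψx]
    refine tendsto_integral_of_dominated_convergence (fun v ↦ ‖(𝓕 ψ : 𝓢(E, ℂ)) v‖) (fun N ↦ ?_)
      (𝓕 ψ : 𝓢(E, ℂ)).integrable.norm (fun N ↦ .of_forall (hbd N x)) (.of_forall fun v ↦ ?_)
    · refine Continuous.aestronglyMeasurable ?_
      have h1 : Continuous (symbol χ ((N : ℤ) + m + 1) : E → ℂ) := (contDiff_symbol hχ _).continuous
      have h2 : Continuous fun v : E ↦ (Real.fourierChar (inner ℝ v x) : ℂ) :=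
        continuous_subtype_val.comp (Real.continuous_fourierChar.comp (by fun_prop))
      exact h2.mul (h1.mul (𝓕 ψ : 𝓢(E, ℂ)).continuous)
    · simp_rw [add_assoc]
      exact ((tendsto_symbol hχ _ v).mul_const _).const_mul _
  have hψb : ∀ N x, ‖ψN N x‖ ≤ ∫ v : E, ‖(𝓕 ψ : 𝓢(E, ℂ)) v‖ := fun N x ↦ by
    rw [hψx]
    exact norm_integral_le_of_norm_le (𝓕 ψ : 𝓢(E, ℂ)).integrable.norm (.of_forall (hbd N x))
  have hN : ∀ N, approxProduct χ m a N (ψ : 𝓢'(E, ℂ)) φ =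
      ∫ x, lowFreqFun χ ((N : ℤ) + m - 1) a x * φ x * ψN N x := fun N ↦ by
    have h1 := hasTemperateGrowth_symbol (E := E) hχ ((N : ℤ) + m + 1)
    change smulLeftCLM ℂ _ (fourierMultiplierCLM ℂ _ (ψ : 𝓢'(E, ℂ))) φ = _
    rw [smulLeftCLM_apply_apply, fourierMultiplierCLM_toTemperedDistributionCLM_eq h1]
    refine (SchwartzMap.toTemperedDistributionCLM_apply_apply volume _ _).trans ?_
    refine integral_congr_ae (.of_forall fun x ↦ ?_)
    simp only [smul_eq_mul]
    rw [SchwartzMap.smulLeftCLM_apply_apply (hasTemperateGrowth_lowFreqFun hχ _ ha.memLp),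
      smul_eq_mul, SchwartzMap.fourierMultiplierCLM_apply]
  simp_rw [hN]
  set M : ℝ := supNorm a * ∫ y : E, ‖kernel χ 0 y‖
  set I : ℝ := ∫ v : E, ‖(𝓕 ψ : 𝓢(E, ℂ)) v‖
  refine tendsto_integral_of_dominated_convergence (fun x ↦ M * ‖φ x‖ * I) (fun N ↦ ?_)
    ((φ.integrable.norm.const_mul _).mul_const _) (fun N ↦ .of_forall fun x ↦ ?_)
    (.of_forall fun x ↦ ?_)
  · have h1 := (hasTemperateGrowth_lowFreqFun hχ ((N : ℤ) + m - 1) ha.memLp).1.continuous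
    exact ((h1.mul φ.continuous).mul (ψN N).continuous).aestronglyMeasurable
  · rw [norm_mul, norm_mul]
    have := norm_lowFreqFun_le hχ ((N : ℤ) + m - 1) ha.memLp x
    have hM : 0 ≤ M := (norm_nonneg _).trans this
    exact mul_le_mul (mul_le_mul_of_nonneg_right this (norm_nonneg _)) (hψb N x) (norm_nonneg _)
      (mul_nonneg hM (norm_nonneg _))
  · have := tendsto_lowFreqFun hχ ha ((m : ℤ) - 1) x
    simp_rw [← add_sub_assoc] at this
    exact (this.mul_const _).mul (hψlim x)

theorem MemLip.memLp_mul_schwartz (ha : MemLip a) (φ : 𝓢(E, ℂ)) :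
    MemLp (fun x ↦ a x * φ x) 2 volume :=
  memLp_bdd_mul (φ.memLp 2 volume) ha.memLp.1 (norm_le_supNorm_ae ha.memLp)

/-- A test function multiplied by a Lipschitz function is the sum of its paraproduct and the
remainder. -/
theorem toLp_mul_schwartz_eq (hχ : IsCutoff χ) (m : ℕ) (ha : MemLip a) (φ : 𝓢(E, ℂ))
    (h₁ : Summable fun j : ℕ ↦ paraTerm χ a (φ : 𝓢'(E, ℂ)) (j + (m + 2)))
    (h₂ : Summable (remainderTerm χ m a (φ : 𝓢'(E, ℂ)))) :
    (((ha.memLp_mul_schwartz φ).toLp : Lp ℂ 2 (volume : Measure E)) : 𝓢'(E, ℂ)) =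
      modifiedParaproduct χ m a φ + ∑' j, remainderTerm χ m a φ j := by
  ext ψ
  have h := PointwiseConvergenceCLM.tendsto_iff_forall_tendsto.mp
    (tendsto_approxProduct hχ m ha.memLp h₁ h₂) ψ
  refine tendsto_nhds_unique ?_ h
  convert tendsto_approxProduct_schwartz hχ m ha φ ψ using 2
  rw [Lp.toTemperedDistribution_apply]
  refine integral_congr_ae ?_
  filter_upwards [(ha.memLp_mul_schwartz φ).coeFn_toLp] with x hx
  rw [hx, smul_eq_mul]
  ring

/-- Multiplication by a Lipschitz function maps test functions into `H^s`: the paraproduct is in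
every Sobolev space, and the remainder is in `H^s` because test functions are in `H^{s-1}`. -/
theorem memSobolev_toLp_mul_schwartz (hχ : IsCutoff χ) (ha : MemLip a) (φ : 𝓢(E, ℂ)) {s : ℝ}
    (hs : s ∈ Set.Ioo (0 : ℝ) 1) :
    MemSobolev s 2
      (((ha.memLp_mul_schwartz φ).toLp : Lp ℂ 2 (volume : Measure E)) : 𝓢'(E, ℂ)) := by
  obtain ⟨C, -, hC⟩ := exists_modifiedParaproduct_bound (E := E) hχ 0 s
  obtain ⟨C', -, hC'⟩ := exists_remainder_bound (E := E) hχ 0 (s := 1 - s)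
    ⟨by linarith [hs.2], by linarith [hs.1]⟩
  have h₁ := hC a ha.memLp φ φ.memSobolev
  have h₂ := hC' a ha φ φ.memSobolev
  rw [toLp_mul_schwartz_eq hχ 0 ha φ h₁.1 h₂.1]
  have h₃ := h₂.2.1
  rw [sub_sub_cancel] at h₃
  exact h₁.2.1.add h₃

theorem inner_star_eq_integral (g f : Lp ℂ 2 (volume : Measure E)) :
    inner ℂ (star g) f = ∫ x, f x * g x := by
  rw [L2.inner_def]
  refine integral_congr_ae ?_
  filter_upwards [Lp.coeFn_star g] with x hx
  rw [hx]
  simp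

/-- The sum of the paraproduct and the remainder is the product `a u`. Both sides of the defining
identity are continuous in `u ∈ H^{-s}`, and for Schwartz functions `u` they agree. -/
theorem isProduct_add_remainder (hχ : IsCutoff χ) (m : ℕ) (ha : MemLip a) {s : ℝ}
    (hs : s ∈ Set.Ioo (0 : ℝ) 1) {u : 𝓢'(E, ℂ)} (hu : MemSobolev (-s) 2 u) :
    IsProduct s a u (modifiedParaproduct χ m a u + ∑' j, remainderTerm χ m a u j) := by
  intro φ
  set w : Lp ℂ 2 (volume : Measure E) := (ha.memLp_mul_schwartz φ).toLp with hw
  obtain ⟨g, hg⟩ := memSobolev_toLp_mul_schwartz hχ ha φ hs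
  obtain ⟨f, hf⟩ := hu
  refine ⟨w, (ha.memLp_mul_schwartz φ).coeFn_toLp, f, g, hf, hg, ?_⟩
  obtain ⟨C, -, hC⟩ := exists_modifiedParaproduct_bound (E := E) hχ m (-s)
  obtain ⟨C', -, hC'⟩ := exists_remainder_bound (E := E) hχ m hs
  -- `J` parametrizes `H^{-s}` by `L²`.
  let J : Lp ℂ 2 (volume : Measure E) →ₗ[ℂ] 𝓢'(E, ℂ) :=
    (besselPotential E ℂ s ∘L Lp.toTemperedDistributionCLM ℂ volume 2).toLinearMap
  have hJ : ∀ f, J f = besselPotential E ℂ s f := fun f ↦ rfl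
  have hJf : ∀ f, besselPotential E ℂ (-s) (J f) = f := fun f ↦ by rw [hJ]; simp
  have hJm : ∀ f, MemSobolev (-s) 2 (J f) := fun f ↦ ⟨f, hJf f⟩
  let V : 𝓢'(E, ℂ) → 𝓢'(E, ℂ) := fun u ↦
    modifiedParaproduct χ m a u + ∑' j, remainderTerm χ m a u j
  have hV : ∀ f, Tendsto (fun N ↦ approxProduct χ m a N (J f) φ) atTop (𝓝 (V (J f) φ)) := fun f ↦
    PointwiseConvergenceCLM.tendsto_iff_forall_tendsto.mp
      (tendsto_approxProduct hχ m ha.memLp (hC a ha.memLp _ (hJm f)).1 (hC' a ha _ (hJm f)).1) φ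
  -- The left-hand side as a functional of `f = J⁻¹ u`; it is linear as a limit of linear
  -- functionals, and bounded by the estimates of the paraproduct and of the remainder.
  let D₀ : Lp ℂ 2 (volume : Measure E) →ₗ[ℂ] ℂ :=
    { toFun := fun f ↦ V (J f) φ
      map_add' := fun f f' ↦ tendsto_nhds_unique (hV (f + f')) <| by
        simpa using (hV f).add (hV f')
      map_smul' := fun c f ↦ tendsto_nhds_unique (hV (c • f)) <| by
        simpa using (hV f).const_mul c }
  let D : StrongDual ℂ (Lp ℂ 2 (volume : Measure E)) :=
    D₀.mkContinuous (C * supNorm a * testNorm s φ + C' * lipNorm a * testNorm (-(1 - s)) φ)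
      fun f ↦ by
        obtain ⟨-, h1, h2⟩ := hC a ha.memLp _ (hJm f)
        obtain ⟨-, h3, h4⟩ := hC' a ha _ (hJm f)
        rw [sobolevNorm_eq (hJf f)] at h2 h4
        have h5 := norm_apply_le_sobolevNorm h1 φ
        have h6 := norm_apply_le_sobolevNorm h3 φ
        rw [neg_neg] at h5
        have h7 := testNorm_nonneg s φ
        have h8 := testNorm_nonneg (-(1 - s)) φ
        calc ‖V (J f) φ‖ ≤ ‖modifiedParaproduct χ m a (J f) φ‖ +
              ‖(∑' j, remainderTerm χ m a (J f) j) φ‖ := norm_add_le _ _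
          _ ≤ (C * supNorm a * ‖f‖) * testNorm s φ +
              (C' * lipNorm a * ‖f‖) * testNorm (-(1 - s)) φ :=
            add_le_add (h5.trans (by gcongr)) (h6.trans (by gcongr))
          _ = _ := by ring
  have hD : ∀ f, D f = V (J f) φ := fun f ↦ rfl
  have hdense : DenseRange (SchwartzMap.toLpCLM ℝ ℂ 2 (volume : Measure E)) :=
    SchwartzMap.denseRange_toLpCLM ENNReal.ofNat_ne_top
  -- The right-hand side is the bilinear pairing with `g`, the inner product with its conjugate.
  have heq : (D : Lp ℂ 2 (volume : Measure E) → ℂ) = innerSL ℂ (star g) := by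
    refine hdense.equalizer D.continuous (innerSL ℂ (star g)).continuous (funext fun θ ↦ ?_)
    simp only [Function.comp_apply, SchwartzMap.toLpCLM_apply, innerSL_apply_apply]
    rw [hD, inner_star_eq_integral]
    have hb : (bracket s : E → ℂ).HasTemperateGrowth := hasTemperateGrowth_bracket s
    set θ' : 𝓢(E, ℂ) := SchwartzMap.fourierMultiplierCLM ℂ (bracket s) θ with hθ'
    have hJθ : J (θ.toLp 2) = (θ' : 𝓢'(E, ℂ)) := by
      rw [hJ, Lp.toTemperedDistribution_toLp_eq]
      exact fourierMultiplierCLM_toTemperedDistributionCLM_eq hb θ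
    have h1 : V (J (θ.toLp 2)) φ = ∫ x, a x * φ x * θ' x := by
      refine tendsto_nhds_unique (hV _) ?_
      rw [hJθ]
      exact tendsto_approxProduct_schwartz hχ m ha θ' φ
    have h2 : ∫ x, a x * φ x * θ' x = (w : 𝓢'(E, ℂ)) θ' := by
      rw [Lp.toTemperedDistribution_apply]
      refine integral_congr_ae ?_
      filter_upwards [(ha.memLp_mul_schwartz φ).coeFn_toLp] with x hx
      rw [hx, smul_eq_mul]
      ring
    have h3 : (w : 𝓢'(E, ℂ)) = besselPotential E ℂ (-s) g := by
      rw [← hg, hw]; simp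
    have h4 : 𝓕 (SchwartzMap.smulLeftCLM ℂ (bracket (-s)) (𝓕⁻ θ')) = θ := by
      rw [hθ', SchwartzMap.fourierMultiplierCLM_apply,
        ← fourier_smul_fourierInv_of_even hb (bracket_even s), fourierInv_fourier_eq]
      conv_rhs => rw [← fourier_fourierInv_eq (F := 𝓢(E, ℂ)) θ]
      congr 1
      ext ξ
      rw [SchwartzMap.smulLeftCLM_apply_apply (by fun_prop),
        SchwartzMap.smulLeftCLM_apply_apply (by fun_prop), smul_eq_mul, smul_eq_mul, ← mul_assoc,
        bracket_neg_mul_bracket, one_mul]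
    rw [h1, h2, h3, besselPotential_apply, h4, Lp.toTemperedDistribution_apply]
    refine integral_congr_ae ?_
    filter_upwards [θ.coeFn_toLp 2 volume] with x hx
    rw [hx, smul_eq_mul]
  have hfin := congrFun heq f
  rw [hD, innerSL_apply_apply, inner_star_eq_integral] at hfin
  have hJu : J f = u := by rw [hJ, ← hf]; simp
  rw [hJu] at hfin
  exact hfin

end Product

end Paraproduct


theorem proposition3p5 (n : ℕ) (χ : ℝ → ℝ) (hχ : Paraproduct.IsCutoff χ) (m : ℕ) :
    (∀ s : ℝ, ∃ C : ℝ, ∀ a : EuclideanSpace ℝ (Fin n) → ℂ, MemLp a ⊤ volume →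
      ∀ u : 𝓢'(EuclideanSpace ℝ (Fin n), ℂ), MemSobolev s 2 u →
        (Summable fun j : ℕ ↦ Paraproduct.paraTerm χ a u (j + (m + 2))) ∧
        MemSobolev s 2 (Paraproduct.modifiedParaproduct χ m a u) ∧
        Paraproduct.sobolevNorm s (Paraproduct.modifiedParaproduct χ m a u) ≤
          C * Paraproduct.supNorm a * Paraproduct.sobolevNorm s u) ∧
    (∀ s ∈ Set.Ioo (0 : ℝ) 1, ∃ C : ℝ, ∀ a : EuclideanSpace ℝ (Fin n) → ℂ, Paraproduct.MemLip a →
      ∀ u : 𝓢'(EuclideanSpace ℝ (Fin n), ℂ), MemSobolev (-s) 2 u →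
        ∃ v : 𝓢'(EuclideanSpace ℝ (Fin n), ℂ), Paraproduct.IsProduct s a u v ∧
          MemSobolev (1 - s) 2 (v - Paraproduct.modifiedParaproduct χ m a u) ∧
          Paraproduct.sobolevNorm (1 - s) (v - Paraproduct.modifiedParaproduct χ m a u) ≤
            C * Paraproduct.lipNorm a * Paraproduct.sobolevNorm (-s) u) := by
  refine ⟨fun s ↦ ?_, fun s hs ↦ ?_⟩
  · obtain ⟨C, -, hC⟩ :=
      Paraproduct.exists_modifiedParaproduct_bound (E := EuclideanSpace ℝ (Fin n)) hχ m s
    exact ⟨C, hC⟩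
  · obtain ⟨C, -, hC⟩ :=
      Paraproduct.exists_remainder_bound (E := EuclideanSpace ℝ (Fin n)) hχ m hs
    refine ⟨C, fun a ha u hu ↦ ⟨_, Paraproduct.isProduct_add_remainder hχ m ha hs hu, ?_⟩⟩
    rw [add_sub_cancel_left]
    exact (hC a ha u hu).2
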